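/- Setting. Let $M$ be a closed connected orientable four-dimensional manifold, represented as a finite simplicial complex $K$ with consistently oriented 4-simplices. Let $\varphi\colon \pi_1(M)\to E_4$ be a homomorphism to the group of (orientation preserving) motions of $\mathbb R^4$, and let $f$ be a $\varphi$-equivariant map, $f(g\cdot x)=\varphi(g)f(x)$, from the vertices of the universal cover of $K$ to $\mathbb R^4$, such that the images of all 4-simplices of the universal cover are nondegenerate. For an edge $a$ of $K$ let $L_a$ be the squared length of the image of any of its lifts; for a 2-face $i$ let $S_i>0$ be the area of the image of any of its lifts; for a 4-simplex $\sigma$ let $V_\sigma$ be the oriented volume of the image of any of its lifts (positive if $f$ preserves the orientation of $\sigma$, negative if $f$ reverses it). Regard the squared edge lengths as independent variables near these values. The inner dihedral angles of each 4-simplex are then functions of the squared lengths of its ten edges, and the deficit angle at a 2-face $i$ is $$\omega_i=-\sum_{\sigma\supset i}\operatorname{sgn}(V_\sigma)\,\vartheta_{\sigma,i}\pmod{2\pi},$$ where $\vartheta_{\sigma,i}\in(0,\pi)$ is the dihedral angle of $\sigma$ at $i$, and the signs $\operatorname{sgn}(V_\sigma)$ are those determined by $f$. The functions $\omega_i$ are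 differentiable at the values of the squared lengths given by $f$; the matrix $(\partial\omega_i/\partial L_a)$, with rows indexed by the 2-faces and columns indexed by the edges, is taken at these values. Theorem. Let $\mathcal B$ be a largest square submatrix with nonzero determinant of $(\partial\omega_i/\partial L_a)$, and suppose that one of its rows corresponds to a 2-face $ABC$ which belongs to exactly three 4-simplices. Then these 4-simplices are $ABCEF$, $ABCDF$, $ABCDE$ for some vertices $D,E,F$. Suppose that $DEF$ is not a face of $K$, and make the move $3\to3$, which replaces these three 4-simplices with $BCDEF$, $ACDEF$, $ABDEF$ (so that the 2-face $ABC$ is replaced with $DEF$, while the vertices, the edges and the remaining 2-faces stay the same), with $f$ unchanged and with the consistent orientation of the new complex that agrees with the old one on the common 4-simplices; suppose that the images of the new 4-simplices are nondegenerate too. Let $\mathcal B'$ be the submatrix of the matrix $(\partial\omega_i/\partial L_a)$ of the new complex with the same rows and columns in the same order, except that the row of $ABC$ is replaced with the row of $DEF$. Then $$\frac{\det\mathcal B'\cdot\prod_{\sigma}V_\sigma}{\prod_{i}S_i}\Bigg|_{\text{new complex}}=\frac{\det\mathcal B\cdot\prod_{\sigma}V_\sigma}{\prod_{i}S_i}\Bigg|_{\text{old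 complex}},$$ where in each complex the products are over all its 4-simplices $\sigma$ and over all its 2-faces $i$. -/

import Mathlib

open scoped Classical

noncomputable section

/-- Euclidean four-space. -/
abbrev E4 : Type := EuclideanSpace ℝ (Fin 4)

namespace AbstractSimplicialComplex

variable {V : Type*}

/-! ### Combinatorics: simplices, triangulated manifolds, orientations -/

/-- The `n`-dimensional simplices of a finite complex. -/
def simplices [Fintype V] (K : AbstractSimplicialComplex V) (n : ℕ) : Finset (Finset V) :=
  Finset.univ.filter fun s => s ∈ K.faces ∧ s.card = n + 1

/-- The `1`-skeleton of a complex. -/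
def skeleton (K : AbstractSimplicialComplex V) : SimpleGraph V where
  Adj v w := v ≠ w ∧ ({v, w} : Finset V) ∈ K.faces
  symm := ⟨fun v w h => ⟨h.1.symm, by rw [Finset.pair_comm]; exact h.2⟩⟩
  loopless := ⟨fun _ h => h.1 rfl⟩

/-- The geometric realization of a finite complex, in barycentric coordinates. -/
def Realization [Fintype V] (K : AbstractSimplicialComplex V) : Type _ :=
  {x : V → ℝ // (∀ v, 0 ≤ x v) ∧ ∑ v, x v = 1 ∧ ∃ s ∈ K.faces, ∀ v, x v ≠ 0 ↔ v ∈ s}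

instance [Fintype V] (K : AbstractSimplicialComplex V) : TopologicalSpace K.Realization :=
  inferInstanceAs (TopologicalSpace
    {x : V → ℝ // (∀ v, 0 ≤ x v) ∧ ∑ v, x v = 1 ∧ ∃ s ∈ K.faces, ∀ v, x v ≠ 0 ↔ v ∈ s})

/-- `K` triangulates a closed connected four-dimensional manifold: its realization is locally
homeomorphic to `ℝ⁴`, its `1`-skeleton is connected, every simplex is a face of a 4-simplex, and
the link of every tetrahedron consists of two points. -/
structure IsClosedFourManifold [Fintype V] (K : AbstractSimplicialComplex V) : Prop where
  locally_euclidean : Nonempty (ChartedSpace E4 K.Realization)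
  connected : K.skeleton.Connected
  pure : ∀ s ∈ K.faces, ∃ r ∈ K.simplices 4, s ⊆ r
  closed : ∀ s ∈ K.simplices 3, ((K.simplices 4).filter fun r => s ⊆ r).card = 2

/-- A consistent orientation of the 4-simplices. Each ordering `v` of the vertices of a 4-simplex
gets a sign, which says whether the ordering is positive; it is multiplied by the sign of a
permutation of the ordering. If two 4-simplices share a tetrahedron then orderings of them which
differ in one vertex only have opposite signs, i.e. the tetrahedron gets opposite orientations from
its two sides. (The values on tuples that do not enumerate a 4-simplex are irrelevant.) -/
structure SimplexOrientation (K : AbstractSimplicialComplex V) where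
  sign : (Fin 5 → V) → ℤˣ
  perm : ∀ v : Fin 5 → V, Function.Injective v → Finset.univ.image v ∈ K.faces →
    ∀ σ : Equiv.Perm (Fin 5), sign (v ∘ σ) = Equiv.Perm.sign σ * sign v
  adjacent : ∀ (v : Fin 5 → V) (i : Fin 5) (w : V), Function.Injective v →
    Finset.univ.image v ∈ K.faces → w ∉ Set.range v →
    Finset.univ.image (Function.update v i w) ∈ K.faces →
    sign (Function.update v i w) = - sign v

/-! ### The move `3 → 3` -/

/-- The 4-simplices of `K` that contain the 2-face `t = ABC` are exactly `ABCEF`, `ABCDF` and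
`ABCDE`, where `u = DEF`. -/
structure IsThreeStar [Fintype V] (K : AbstractSimplicialComplex V) (t u : Finset V) : Prop where
  card_left : t.card = 3
  card_right : u.card = 3
  disjoint : Disjoint t u
  star : ∀ s : Finset V, (s ∈ K.simplices 4 ∧ t ⊆ s) ↔ ∃ y ∈ u, s = (t ∪ u).erase y

/-- The complex after the move `3 → 3`: all simplices containing `t = ABC` are removed; the new
simplices are those that contain `u = DEF`, have all their vertices among `ABCDEF` and do not
contain `ABC`. In particular the 4-simplices `ABCEF`, `ABCDF`, `ABCDE` are replaced with `BCDEF`,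
`ACDEF`, `ABDEF`. -/
def flip [Fintype V] (K : AbstractSimplicialComplex V) (t u : Finset V)
    (h : K.IsThreeStar t u) : AbstractSimplicialComplex V where
  faces := {s | s ∈ K.faces ∧ ¬ t ⊆ s} ∪ {s | u ⊆ s ∧ s ⊆ t ∪ u ∧ ¬ t ⊆ s}
  isRelLowerSet_faces := by
    have huu : u.Nonempty := Finset.card_pos.1 (by rw [h.card_right]; norm_num)
    rintro s (⟨hs, hts⟩ | ⟨hus, hsu, hts⟩)
    · exact ⟨(K.isRelLowerSet_faces hs).1, fun r hr hne =>
        Or.inl ⟨(K.isRelLowerSet_faces hs).2 hr hne, fun htr => hts (htr.trans hr)⟩⟩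
    · refine ⟨huu.mono hus, fun r hr hne => ?_⟩
      have htr : ¬ t ⊆ r := fun htr => hts (htr.trans hr)
      by_cases hur : u ⊆ r
      · exact Or.inr ⟨hur, Finset.Subset.trans hr hsu, htr⟩
      · obtain ⟨y, hyu, hyr⟩ := Finset.not_subset.1 hur
        have hmem := ((h.star _).2 ⟨y, hyu, rfl⟩).1
        rw [simplices, Finset.mem_filter] at hmem
        refine Or.inl ⟨(K.isRelLowerSet_faces hmem.2.1).2 ?_ hne, htr⟩
        intro x hx
        exact Finset.mem_erase.2 ⟨fun hxy => hyr (hxy ▸ hx), hsu (hr hx)⟩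
  singleton_mem v := by
    refine Or.inl ⟨K.singleton_mem v, fun hsub => ?_⟩
    have := Finset.card_le_card hsub
    rw [h.card_left, Finset.card_singleton] at this
    omega

/-! ### The fundamental group and the universal cover, through edge paths -/

/-- Homotopy of edge paths: the congruence generated by cancelling a backtracking and by replacing
two sides of a triangle of the complex with the third one. -/
inductive Homotopic (K : AbstractSimplicialComplex V) :
    ∀ {v w : V}, K.skeleton.Walk v w → K.skeleton.Walk v w → Prop
  | refl {v w : V} (p : K.skeleton.Walk v w) : Homotopic K p p
  | symm {v w : V} {p q : K.skeleton.Walk v w} : Homotopic K p q → Homotopic K q p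
  | trans {v w : V} {p q r : K.skeleton.Walk v w} :
      Homotopic K p q → Homotopic K q r → Homotopic K p r
  | cons {v w x : V} (h : K.skeleton.Adj v w) {p q : K.skeleton.Walk w x} :
      Homotopic K p q → Homotopic K (.cons h p) (.cons h q)
  | backtrack {v w x : V} (h : K.skeleton.Adj v w) (p : K.skeleton.Walk v x) :
      Homotopic K (.cons h (.cons h.symm p)) p
  | triangle {v w x y : V} (h₁ : K.skeleton.Adj v w) (h₂ : K.skeleton.Adj w x)
      (h₃ : K.skeleton.Adj v x) (hT : ({v, w, x} : Finset V) ∈ K.faces)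
      (p : K.skeleton.Walk x y) : Homotopic K (.cons h₁ (.cons h₂ p)) (.cons h₃ p)

namespace Homotopic

variable {K : AbstractSimplicialComplex V}

theorem append_left {v w x : V} {p q : K.skeleton.Walk v w} (h : Homotopic K p q)
    (r : K.skeleton.Walk w x) : Homotopic K (p.append r) (q.append r) := by
  induction h with
  | refl p => exact .refl _
  | symm _ ih => exact (ih r).symm
  | trans _ _ ih₁ ih₂ => exact (ih₁ r).trans (ih₂ r)
  | cons e _ ih => exact .cons e (ih r)
  | backtrack e p => exact .backtrack e _
  | triangle h₁ h₂ h₃ hT p => exact .triangle h₁ h₂ h₃ hT _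

theorem append_right {v w x : V} (p : K.skeleton.Walk v w) {q r : K.skeleton.Walk w x}
    (h : Homotopic K q r) : Homotopic K (p.append q) (p.append r) := by
  induction p with
  | nil => exact h
  | cons e p ih => exact .cons e (ih h)

theorem reverse_append {v w : V} (p : K.skeleton.Walk v w) :
    Homotopic K (p.reverse.append p) .nil := by
  induction p with
  | nil => exact .refl _
  | cons e p ih =>
    rw [SimpleGraph.Walk.reverse_cons, ← SimpleGraph.Walk.append_assoc]
    have hb := Homotopic.backtrack (K := K) e.symm p
    exact (append_right p.reverse hb).trans ih

theorem append_reverse {v w : V} (p : K.skeleton.Walk v w) :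
    Homotopic K (p.append p.reverse) .nil := by
  simpa using reverse_append p.reverse

theorem reverse {v w : V} {p q : K.skeleton.Walk v w} (h : Homotopic K p q) :
    Homotopic K p.reverse q.reverse := by
  have h₁ : Homotopic K p.reverse (p.reverse.append (q.append q.reverse)) := by
    have := append_right p.reverse (append_reverse q).symm
    simpa using this
  have h₂ : Homotopic K (p.reverse.append (q.append q.reverse)) q.reverse := by
    have h₃ := append_right p.reverse (append_left h.symm q.reverse)
    have h₄ := append_left (reverse_append p) q.reverse
    rw [← SimpleGraph.Walk.append_assoc] at h₄
    exact h₃.trans (by simpa using h₄)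
  exact h₁.trans h₂

end Homotopic

/-- Edge paths from `v` to `w` up to homotopy. -/
def homotopySetoid (K : AbstractSimplicialComplex V) (v w : V) : Setoid (K.skeleton.Walk v w) where
  r := Homotopic K
  iseqv := ⟨Homotopic.refl, Homotopic.symm, Homotopic.trans⟩

/-- Homotopy classes of edge paths from `v` to `w`. -/
def PathClass (K : AbstractSimplicialComplex V) (v w : V) : Type _ :=
  Quotient (K.homotopySetoid v w)

namespace PathClass

variable {K : AbstractSimplicialComplex V} {v w x : V}

/-- The class of an edge path. -/
def mk (p : K.skeleton.Walk v w) : K.PathClass v w := Quotient.mk (K.homotopySetoid v w) p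

/-- Concatenation. -/
def comp (p : K.PathClass v w) (q : K.PathClass w x) : K.PathClass v x :=
  Quotient.map₂ (sa := K.homotopySetoid v w) (sb := K.homotopySetoid w x)
    (sc := K.homotopySetoid v x) SimpleGraph.Walk.append
    (fun _ _ h₁ _ _ h₂ => (Homotopic.append_left h₁ _).trans (Homotopic.append_right _ h₂)) p q

/-- The reversed path. -/
def reverse (p : K.PathClass v w) : K.PathClass w v :=
  Quotient.map (sa := K.homotopySetoid v w) (sb := K.homotopySetoid w v)
    SimpleGraph.Walk.reverse (fun _ _ h => Homotopic.reverse h) p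

end PathClass

/-- The fundamental group of `K` with base vertex `v₀`: homotopy classes of closed edge paths. -/
def EdgePathGroup (K : AbstractSimplicialComplex V) (v₀ : V) : Type _ := K.PathClass v₀ v₀

instance (K : AbstractSimplicialComplex V) (v₀ : V) : Group (K.EdgePathGroup v₀) where
  mul g h := PathClass.comp g h
  one := PathClass.mk .nil
  inv g := PathClass.reverse g
  mul_assoc a b c := by
    induction a using Quotient.inductionOn
    induction b using Quotient.inductionOn
    induction c using Quotient.inductionOn
    exact congrArg PathClass.mk (SimpleGraph.Walk.append_assoc _ _ _).symm
  one_mul a := by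
    induction a using Quotient.inductionOn
    exact congrArg PathClass.mk (SimpleGraph.Walk.nil_append _)
  mul_one a := by
    induction a using Quotient.inductionOn
    exact congrArg PathClass.mk (SimpleGraph.Walk.append_nil _)
  inv_mul_cancel a := by
    induction a using Quotient.inductionOn
    exact Quotient.sound (s := K.homotopySetoid v₀ v₀) (Homotopic.reverse_append _)

/-- The vertices of the universal cover of `K`: homotopy classes of edge paths that start at `v₀`.
The first component, the end of the path, is the image under the covering map. -/
def CoverVertex (K : AbstractSimplicialComplex V) (v₀ : V) : Type _ := Σ w : V, K.PathClass v₀ w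

namespace CoverVertex

variable {K : AbstractSimplicialComplex V} {v₀ : V}

/-- The action of the fundamental group on the universal cover. -/
def act (g : K.EdgePathGroup v₀) (x : K.CoverVertex v₀) : K.CoverVertex v₀ :=
  ⟨x.1, PathClass.comp g x.2⟩

/-- The vertex of the universal cover over `w` that is joined with `x` by the lift of the edge `h`
that starts at `x`. -/
def step (x : K.CoverVertex v₀) {w : V} (h : K.skeleton.Adj x.1 w) : K.CoverVertex v₀ :=
  ⟨w, PathClass.comp x.2 (PathClass.mk (.cons h .nil))⟩

end CoverVertex

/-! ### Euclidean geometry: lengths, areas, oriented volumes, deficit angles -/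

/-- A homomorphism `hol` from the fundamental group to the group of (orientation preserving) motions
of `ℝ⁴`, and a map `pos` from the vertices of the universal cover to `ℝ⁴` that is equivariant with
respect to it. -/
structure Placement (K : AbstractSimplicialComplex V) (v₀ : V) where
  hol : K.EdgePathGroup v₀ →* (E4 ≃ᵃⁱ[ℝ] E4)
  hol_proper : ∀ g, 0 < LinearMap.det ((hol g).linearIsometryEquiv.toLinearEquiv : E4 →ₗ[ℝ] E4)
  pos : K.CoverVertex v₀ → E4
  equivariant : ∀ (g : K.EdgePathGroup v₀) (x : K.CoverVertex v₀), pos (x.act g) = hol g (pos x)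

namespace Placement

variable {K : AbstractSimplicialComplex V} {v₀ : V}

/-- The images in `ℝ⁴` of the vertex `x` of the universal cover (over the vertex `x.1` of `K`) and
of its neighbours, indexed by the underlying vertices of `K`. -/
def place (D : K.Placement v₀) (x : K.CoverVertex v₀) (w : V) : E4 :=
  if h : K.skeleton.Adj x.1 w then D.pos (x.step h) else D.pos x

/-- On the vertices of the simplex `s`, `P` is the image in `ℝ⁴` of a lift of `s` to the universal
cover. Only the edges of `s` have to be in `K`; thus the notion applies as well to the simplices
that result from a move `3 → 3`, which changes neither the edges nor the vertices of the universal
cover. -/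
def IsLift (D : K.Placement v₀) (s : Finset V) (P : V → E4) : Prop :=
  ∃ x : K.CoverVertex v₀, x.1 ∈ s ∧ P = D.place x

/-- The images of the lifts of all 4-simplices of the complex `C` are nondegenerate. -/
def IsNondegenerate [Fintype V] (D : K.Placement v₀) (C : AbstractSimplicialComplex V) : Prop :=
  ∀ s ∈ C.simplices 4, ∀ P, D.IsLift s P → AffineIndependent ℝ fun w : s => P w

/-- The squared length of an edge (the common value for all its lifts). -/
def sqLength (D : K.Placement v₀) (e : Finset V) : ℝ :=
  Classical.epsilon fun r : ℝ => ∃ (P : V → E4) (a b : V), D.IsLift e P ∧ e = {a, b} ∧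
    r = dist (P a) (P b) ^ 2

/-- The area of a 2-face (the common value for all its lifts). -/
def area (D : K.Placement v₀) (t : Finset V) : ℝ :=
  Classical.epsilon fun r : ℝ => ∃ (P : V → E4) (a b c : V), D.IsLift t P ∧ t = {a, b, c} ∧
    r = √(‖P b - P a‖ ^ 2 * ‖P c - P a‖ ^ 2 - inner ℝ (P b - P a) (P c - P a) ^ 2) / 2

/-- The oriented volume of a 4-simplex of the oriented complex `C` (the common value for all its
lifts and all orderings of its vertices): it is positive if the map to `ℝ⁴` preserves the
orientation of the simplex and negative if the map reverses it. -/
def volume {C : AbstractSimplicialComplex V} (D : K.Placement v₀) (o : C.SimplexOrientation)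
    (s : Finset V) : ℝ :=
  Classical.epsilon fun r : ℝ => ∃ (P : V → E4) (v : Fin 5 → V), D.IsLift s P ∧
    Function.Injective v ∧ Finset.univ.image v = s ∧
    r = ((o.sign v : ℤ) : ℝ) *
      (Matrix.of fun i j : Fin 4 => (P (v i.succ) - P (v 0)) j).det / 24

end Placement

/-- The component of the vector `z` orthogonal to the plane spanned by `x` and `y`. -/
def normalPart (x y z : E4) : E4 := (Submodule.span ℝ {x, y})ᗮ.starProjection z

/-- `θ` is the inner dihedral angle, at the 2-face `t = abc`, of a Euclidean 4-simplex `s = abcde`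
whose squared edge lengths are given by `L`: if `P` are vertices in `ℝ⁴` of such a 4-simplex, it is
the angle between the directions, orthogonal to the plane of `abc`, in which the tetrahedra `abcd`
and `abce` leave this plane. -/
def IsDihedralAngle (L : Finset V → ℝ) (t s : Finset V) (θ : ℝ) : Prop :=
  ∃ (P : V → E4) (a b c d e : V), t = {a, b, c} ∧ s = {a, b, c, d, e} ∧
    (∀ x ∈ s, ∀ y ∈ s, x ≠ y → dist (P x) (P y) ^ 2 = L {x, y}) ∧
    θ = InnerProductGeometry.angle
      (normalPart (P b - P a) (P c - P a) (P d - P a))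
      (normalPart (P b - P a) (P c - P a) (P e - P a))

/-- The inner dihedral angle at the 2-face `t` of the 4-simplex `s` as a function of the squared
edge lengths `L`. -/
def dihedralAngle (L : Finset V → ℝ) (t s : Finset V) : ℝ :=
  Classical.epsilon fun θ : ℝ => IsDihedralAngle L t s θ

namespace Placement

variable [Fintype V] {K C : AbstractSimplicialComplex V} {v₀ : V}

/-- The deficit angle at the 2-face `t` of the oriented complex `C` (a representative of its class
modulo `2π`) as a function of the squared lengths `L` of all edges, regarded as independent
variables: minus the sum of the dihedral angles at `t`, each with the sign of the oriented volume of
its 4-simplex. -/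
def deficit (D : K.Placement v₀) (o : C.SimplexOrientation) (t : Finset V)
    (L : Finset V → ℝ) : ℝ :=
  - ∑ s ∈ (C.simplices 4).filter (fun s => t ⊆ s),
      Real.sign (D.volume o s) * dihedralAngle L t s

/-- The partial derivative of the deficit angle at the 2-face `t` with respect to the squared length
of the edge `e`, at the squared lengths obtained from the placement. -/
def deficitDeriv (D : K.Placement v₀) (o : C.SimplexOrientation) (t e : Finset V) : ℝ :=
  deriv (fun l => D.deficit o t (Function.update D.sqLength e l)) (D.sqLength e)

/-- The matrix of those partial derivatives with rows `r` and columns `c`. -/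
def deficitMatrix (D : K.Placement v₀) (o : C.SimplexOrientation) {m : ℕ}
    (r c : Fin m → Finset V) : Matrix (Fin m) (Fin m) ℝ :=
  Matrix.of fun i j => D.deficitDeriv o (r i) (c j)

/-- Rows `r` (2-faces) and columns `c` (edges) form a largest square submatrix with nonzero
determinant of the matrix of all partial derivatives of deficit angles. -/
def IsLargestNonsingular (D : K.Placement v₀) (o : C.SimplexOrientation) {m : ℕ}
    (r c : Fin m → Finset V) : Prop :=
  (∀ i, r i ∈ C.simplices 2) ∧ (∀ j, c j ∈ C.simplices 1) ∧ (D.deficitMatrix o r c).det ≠ 0 ∧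
  ∀ (k : ℕ) (r' c' : Fin k → Finset V), (∀ i, r' i ∈ C.simplices 2) →
    (∀ j, c' j ∈ C.simplices 1) → (D.deficitMatrix o r' c').det ≠ 0 → k ≤ m

/-- The expression `det B · ∏ V / ∏ S`, with the products over all 4-simplices and over all
2-faces. -/
def invariantExpr (D : K.Placement v₀) (o : C.SimplexOrientation) {m : ℕ}
    (r c : Fin m → Finset V) : ℝ :=
  (D.deficitMatrix o r c).det * (∏ s ∈ C.simplices 4, D.volume o s) /
    ∏ t ∈ C.simplices 2, D.area t

end Placement

end AbstractSimplicialComplex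

end

/-! The six vertices of the star, X = {A,...,F}, span the boundary of a 5-simplex, and the move
exchanges the three 4-simplices around ABC for the three around DEF. All six vertices lift together
to ℝ⁴, where their images satisfy an affine dependency ∑ w_x P_x = 0, ∑ w_x = 0. By Cramer's rule
w_x is, up to sign, 24 times the volume of the 4-simplex that omits x. With orientations taken into
account, the old volumes are ε w_x / 24 and the new ones are -ε w_x / 24 for a common sign ε
(`exists_affine_dependency`, `IsThreeStar.exists_orientation`, `IsThreeStar.exists_weights`).

Hence the new deficit angle at a 2-face minus the old one is ε times the sum of its dihedral angles
in all the boundary 4-simplices that contain it, with signs sgn w_x (`IsThreeStar.deficit_flip`).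
The core is the derivative of such a sum at a face r of X with respect to the squared length of an
edge e: it equals S_r / (2 ∏_{x ∉ r} w_x) times ∑ w_x w_y ∂L_xy/∂L_e, a factor depending on r times
a factor depending on e (`hasDerivAt_signed_angle_sum`). The reason is that the 3×3 Gram matrix of
the normals to r has w in its kernel, and on the kernel the quadratic form of the velocity survives
each elimination that leads from squared lengths to normals (`sum_schurDeriv`).

The matrix of derivatives therefore changes by a matrix of rank one
(`IsThreeStar.deficitDeriv_flip`). The row of ABC becomes zero after the move and the row of DEF is
zero before it, so both are multiples of the same vector, and every other row changes by a multiple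
of the row of ABC. The determinant is thus multiplied by -(S_DEF w_D w_E w_F) / (S_ABC w_A w_B w_C),
and the product of volumes by -(w_A w_B w_C) / (w_D w_E w_F); the areas account for the rest. -/

noncomputable section

/-! ### Determinants of 4-simplices -/

/-- The determinant of the edge vectors of a 4-simplex, 24 times its oriented volume. -/
def simplexDet (Q : Fin 5 → E4) : ℝ :=
  (Matrix.of fun i j : Fin 4 => (Q i.succ - Q 0) j).det

/-- Subtract the first row from the others and expand along the column of ones. The bordered form
treats the five points alike, which permutations and the affine dependency require. -/
theorem simplexDet_eq_bordered (Q : Fin 5 → E4) :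
    simplexDet Q = (Matrix.of fun i : Fin 5 => (Fin.cons 1 (fun j => Q i j) : Fin 5 → ℝ)).det := by
  have h := Matrix.det_eq_of_forall_row_eq_smul_add_const
    (A := Matrix.of fun i : Fin 5 => (Fin.cons 1 (fun j => Q i j) : Fin 5 → ℝ))
    (B := Matrix.of fun i : Fin 5 => (Fin.cons (if i = 0 then 1 else 0)
      (fun j => if i = 0 then Q 0 j else (Q i - Q 0) j) : Fin 5 → ℝ))
    (fun i => if i = 0 then 0 else 1) 0 (by simp) (by
      intro i j
      by_cases hi : i = 0
      · subst hi
        refine Fin.cases ?_ (fun j => ?_) j <;> simp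
      · refine Fin.cases ?_ (fun j => ?_) j <;> simp [hi])
  rw [h, Matrix.det_succ_column_zero, Fin.sum_univ_succ]
  simp only [Matrix.of_apply, Fin.cons_zero, Fin.succ_ne_zero, if_false, mul_zero, zero_mul,
    Finset.sum_const_zero, add_zero, if_true]
  simp [simplexDet, Matrix.submatrix]

theorem simplexDet_perm (Q : Fin 5 → E4) (σ : Equiv.Perm (Fin 5)) :
    simplexDet (Q ∘ σ) = ((Equiv.Perm.sign σ : ℤ) : ℝ) * simplexDet Q := by
  rw [simplexDet_eq_bordered, simplexDet_eq_bordered, ← Matrix.det_permute]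
  rfl

/-- The coefficients of the affine dependency of six points in four-space. -/
theorem exists_affine_dependency (Q : Fin 6 → E4) :
    let c : Fin 6 → ℝ := fun k => (-1) ^ (k : ℕ) * simplexDet (Q ∘ k.succAbove)
    ∑ k, c k = 0 ∧ ∑ k, c k • Q k = 0 := by
  -- A column `w` is adjoined to the 6×5 bordered matrix and the determinant expanded along it. If
  -- `w` repeats the ones or a coordinate column, the determinant vanishes.
  have key (w : Fin 6 → ℝ) : ∑ k : Fin 6, (-1) ^ (k : ℕ) * w k * simplexDet (Q ∘ k.succAbove) =
      (Matrix.of fun i : Fin 6 => (Fin.cons (w i)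
        (Fin.cons 1 (fun j => Q i j) : Fin 5 → ℝ) : Fin 6 → ℝ)).det := by
    rw [Matrix.det_succ_column_zero]
    refine Finset.sum_congr rfl fun k _ => ?_
    rw [simplexDet_eq_bordered]
    rfl
  constructor
  · have h := key fun _ => 1
    rw [Matrix.det_zero_of_column_eq (i := 0) (j := 1) (by decide) (fun i => rfl)] at h
    simpa using h
  · ext j
    have h := key fun k => Q k j
    rw [Matrix.det_zero_of_column_eq (i := 0) (j := j.succ.succ)
      (Fin.succ_ne_zero _).symm (fun i => rfl)] at h
    simp only [WithLp.ofLp_sum, WithLp.ofLp_smul, Finset.sum_apply, Pi.smul_apply, smul_eq_mul,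
      PiLp.zero_apply]
    exact (Finset.sum_congr rfl fun k _ => by ring).trans h

theorem simplexDet_sq (Q : Fin 5 → E4) : simplexDet Q ^ 2 =
    (Matrix.of fun i j : Fin 4 => (inner ℝ (Q i.succ - Q 0) (Q j.succ - Q 0) : ℝ)).det := by
  rw [sq, simplexDet]
  nth_rewrite 2 [← Matrix.det_transpose]
  rw [← Matrix.det_mul]
  congr 1
  ext i j
  simp [Matrix.mul_apply, PiLp.inner_apply, mul_comm]

/-- The determinant is multiplied by that of the linear part. Its square depends on inner products
only, so for a nondegenerate simplex that factor squares to 1, and positivity selects 1. -/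
theorem simplexDet_isometry (φ : E4 ≃ᵃⁱ[ℝ] E4)
    (hφ : 0 < LinearMap.det (φ.linearIsometryEquiv.toLinearEquiv : E4 →ₗ[ℝ] E4))
    (Q : Fin 5 → E4) : simplexDet (φ ∘ Q) = simplexDet Q := by
  set A : E4 →ₗ[ℝ] E4 := (φ.linearIsometryEquiv.toLinearEquiv : E4 →ₗ[ℝ] E4) with hA
  let b := (EuclideanSpace.basisFun (Fin 4) ℝ).toBasis
  have hsub (x y : E4) : φ x - φ y = A (x - y) :=
    (φ.toAffineEquiv.toAffineMap.linearMap_vsub x y).symm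
  have hmat : (Matrix.of fun i j : Fin 4 => ((φ ∘ Q) i.succ - (φ ∘ Q) 0) j) =
      (Matrix.of fun i j : Fin 4 => (Q i.succ - Q 0) j) * (LinearMap.toMatrix b b A).transpose := by
    ext i j
    have h2 := congrFun (LinearMap.toMatrix_mulVec_repr b b A (Q i.succ - Q 0)) j
    have h4 (x : E4) (k : Fin 4) : b.repr x k = x k := by simp [b]
    simp only [Matrix.mulVec, dotProduct, h4] at h2
    have h1 : ((φ ∘ Q) i.succ - (φ ∘ Q) 0) j = A (Q i.succ - Q 0) j :=
      congrArg (fun z : E4 => z j) (hsub _ _)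
    refine (h1.trans h2.symm).trans ?_
    simp only [Matrix.mul_apply, Matrix.of_apply, Matrix.transpose_apply]
    exact Finset.sum_congr rfl fun k _ => mul_comm _ _
  have hmul : simplexDet (φ ∘ Q) = LinearMap.det A * simplexDet Q := by
    rw [simplexDet, hmat, Matrix.det_mul, Matrix.det_transpose, LinearMap.det_toMatrix, mul_comm,
      simplexDet]
  have hsq : simplexDet (φ ∘ Q) ^ 2 = simplexDet Q ^ 2 := by
    rw [simplexDet_sq, simplexDet_sq]
    congr 2
    ext i j
    simp only [Function.comp_apply, hsub]
    exact φ.linearIsometryEquiv.inner_map_map _ _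
  rcases eq_or_ne (simplexDet Q) 0 with h0 | h0
  · rw [hmul, h0, mul_zero]
  · have h1 : LinearMap.det A ^ 2 = 1 := by
      rw [hmul, mul_pow] at hsq
      exact mul_right_cancel₀ (pow_ne_zero 2 h0) (hsq.trans (one_mul _).symm)
    rw [hmul, (pow_eq_one_iff_of_nonneg hφ.le two_ne_zero).1 h1, one_mul]

theorem simplexDet_ne_zero_iff (Q : Fin 5 → E4) :
    simplexDet Q ≠ 0 ↔ LinearIndependent ℝ fun i : Fin 4 => Q i.succ - Q 0 := by
  rw [simplexDet, ← isUnit_iff_ne_zero, ← Matrix.isUnit_iff_isUnit_det,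
    ← Matrix.linearIndependent_rows_iff_isUnit]
  have := LinearMap.linearIndependent_iff
    ((WithLp.linearEquiv 2 ℝ (Fin 4 → ℝ)) : E4 →ₗ[ℝ] (Fin 4 → ℝ)) (LinearEquiv.ker _)
    (v := fun i : Fin 4 => Q i.succ - Q 0)
  rw [← this]
  rfl

theorem simplexDet_ne_zero_of_affineIndependent {Q : Fin 5 → E4} (h : AffineIndependent ℝ Q) :
    simplexDet Q ≠ 0 := by
  rw [simplexDet_ne_zero_iff]
  have h1 := (affineIndependent_iff_linearIndependent_vsub ℝ Q 0).1 h
  exact h1.comp (fun i : Fin 4 => ⟨i.succ, Fin.succ_ne_zero i⟩) fun i j hij => by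
    simpa using hij

namespace AbstractSimplicialComplex

/-! ### Gram matrices and Schur complements -/

/-- The entries of the Schur complement of the entry `b`, `b` in the symmetric matrix `g`. -/
def schur {ι : Type*} (g : ι → ι → ℝ) (b x y : ι) : ℝ := g x y - g x b * g y b / g b b

theorem schur_comm {ι : Type*} {g : ι → ι → ℝ} (hg : ∀ x y, g x y = g y x) (b x y : ι) :
    schur g b x y = schur g b y x := by
  rw [schur, schur, hg x y, mul_comm]

theorem inner_sub_smul_self (x z : E4) :
    inner ℝ (z - (inner ℝ z x / inner ℝ x x : ℝ) • x) x = (0 : ℝ) := by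
  rw [inner_sub_left, real_inner_smul_left]
  by_cases h : x = 0
  · simp [h]
  · rw [div_mul_cancel₀ _ (by simpa using h), sub_self]

theorem inner_sub_smul_sub_smul (x z w : E4) :
    inner ℝ (z - (inner ℝ z x / inner ℝ x x : ℝ) • x) (w - (inner ℝ w x / inner ℝ x x : ℝ) • x) =
      schur (fun u v : E4 => (inner ℝ u v : ℝ)) x z w := by
  rw [inner_sub_right, real_inner_smul_right, inner_sub_smul_self, inner_sub_left,
    real_inner_smul_left, schur, real_inner_comm w x]
  ring

/-- Two Gram–Schmidt steps. Degenerate `x` or `p y` do no harm, because the meaningless quotient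
then multiplies the zero vector. -/
theorem normalPart_eq (x y z : E4) :
    let p : E4 → E4 := fun w => w - (inner ℝ w x / inner ℝ x x : ℝ) • x
    normalPart x y z = p z - (inner ℝ (p z) (p y) / inner ℝ (p y) (p y) : ℝ) • p y := by
  intro p
  set n := p z - (inner ℝ (p z) (p y) / inner ℝ (p y) (p y) : ℝ) • p y with hn
  have hx : x ∈ Submodule.span ℝ {x, y} := Submodule.subset_span (by simp)
  have hy : y ∈ Submodule.span ℝ {x, y} := Submodule.subset_span (by simp)
  have h1 : inner ℝ n x = (0 : ℝ) := by
    rw [hn, inner_sub_left, real_inner_smul_left, inner_sub_smul_self, inner_sub_smul_self]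
    simp
  have h2 : inner ℝ n y = (0 : ℝ) := by
    have h3 : y = p y + (inner ℝ y x / inner ℝ x x : ℝ) • x := by simp [p]
    rw [h3, inner_add_right, real_inner_smul_right, h1, mul_zero, add_zero]
    exact inner_sub_smul_self _ _
  refine Submodule.eq_starProjection_of_mem_orthogonal (K := (Submodule.span ℝ {x, y})ᗮ)
    (v := n) ?_ ?_
  · rw [Submodule.mem_orthogonal']
    intro w hw
    induction hw using Submodule.span_induction with
    | mem w hw => rcases hw with rfl | rfl <;> assumption
    | zero => simp
    | add u v _ _ hu hv => rw [inner_add_right, hu, hv, add_zero]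
    | smul r u _ hu => rw [real_inner_smul_right, hu, mul_zero]
  · apply Submodule.le_orthogonal_orthogonal
    have h4 : z - n = (inner ℝ z x / inner ℝ x x : ℝ) • x +
        (inner ℝ (p z) (p y) / inner ℝ (p y) (p y) : ℝ) •
          (y - (inner ℝ y x / inner ℝ x x : ℝ) • x) := by
      simp only [hn, p]
      abel
    rw [h4]
    exact add_mem (Submodule.smul_mem _ _ hx)
      (Submodule.smul_mem _ _ (sub_mem hy (Submodule.smul_mem _ _ hx)))

/-- Each Gram–Schmidt step acts on the Gram matrix as a Schur complement; this turns dihedral angles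
into algebra in the squared lengths. -/
theorem inner_normalPart (x y z w : E4) : inner ℝ (normalPart x y z) (normalPart x y w) =
    schur (schur (fun u v : E4 => (inner ℝ u v : ℝ)) x) y z w := by
  rw [normalPart_eq, normalPart_eq, inner_sub_smul_sub_smul, schur]
  simp only [inner_sub_smul_sub_smul]
  rfl

/-- The determinant of a 4-simplex in terms of successive Schur complements. -/
theorem schur_simplexDet {V : Type*} (P : V → E4) {a b c d e : V}
    (h : simplexDet (P ∘ ![a, b, c, d, e]) ≠ 0) :
    let g : V → V → ℝ := fun x y => inner ℝ (P x - P a) (P y - P a)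
    0 < g b b ∧ 0 < schur g b c c ∧ 0 < schur (schur g b) c d d ∧ 0 < schur (schur g b) c e e ∧
      g b b * schur g b c c * (schur (schur g b) c d d * schur (schur g b) c e e -
        schur (schur g b) c d e ^ 2) = simplexDet (P ∘ ![a, b, c, d, e]) ^ 2 := by
  intro g
  have hli := (simplexDet_ne_zero_iff _).1 h
  have hb : P b - P a ≠ 0 := hli.ne_zero 0
  have h1 : 0 < g b b := real_inner_self_pos.2 hb
  have h2 : 0 < schur g b c c := by
    have h3 : schur g b c c = _ := (inner_sub_smul_sub_smul (P b - P a) (P c - P a) _).symm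
    rw [h3]
    refine real_inner_self_pos.2 fun h4 => ?_
    -- If the projection vanished, its defining formula would be a linear relation between edge
    -- vectors with coefficient 1 at `P c - P a`.
    have h5 := Fintype.linearIndependent_iff.1 hli
      ![-(inner ℝ (P c - P a) (P b - P a) / inner ℝ (P b - P a) (P b - P a) : ℝ), 1, 0, 0]
      (by
        rw [← h4]
        simp [Fin.sum_univ_succ]
        abel) 1
    simp at h5
  have h3 : g b b * schur g b c c * (schur (schur g b) c d d * schur (schur g b) c e e -
      schur (schur g b) c d e ^ 2) = simplexDet (P ∘ ![a, b, c, d, e]) ^ 2 := by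
    have hg (x y : V) : g x y = g y x := real_inner_comm _ _
    have hm : (Matrix.of fun i j : Fin 4 => (inner ℝ ((P ∘ ![a, b, c, d, e]) i.succ -
        (P ∘ ![a, b, c, d, e]) 0) ((P ∘ ![a, b, c, d, e]) j.succ -
        (P ∘ ![a, b, c, d, e]) 0) : ℝ)) =
        Matrix.of fun i j : Fin 4 => g (![b, c, d, e] i) (![b, c, d, e] j) := rfl
    rw [simplexDet_sq, hm]
    -- An LDLᵀ decomposition: `g` is written as its Schur complement plus a product of multipliers,
    -- twice. This removes the divisions, so that `ring` can expand the determinant.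
    have e1 (x : V) : ∃ r, g x b = r * g b b := ⟨g x b / g b b, by field_simp⟩
    have e2 (x : V) : ∃ r, schur g b x c = r * schur g b c c :=
      ⟨schur g b x c / schur g b c c, by field_simp⟩
    choose r hr using e1
    choose q hq using e2
    have e3 (x y : V) : g x y = schur g b x y + r x * r y * g b b := by
      rw [schur, hr x, hr y]; field_simp; ring
    have e4 (x y : V) : schur g b x y = schur (schur g b) c x y + q x * q y * schur g b c c := by
      have e5 : schur (schur g b) c x y =
        schur g b x y - schur g b x c * schur g b y c / schur g b c c := rfl
      rw [e5, hq x, hq y]; field_simp; ring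
    have hs (x y : V) : schur (schur g b) c x y = schur (schur g b) c y x :=
      schur_comm (schur_comm hg b) c x y
    simp [Matrix.det_succ_row_zero, Fin.sum_univ_succ, Fin.succAbove, hg b c, hg b d, hg b e,
      hg c d, hg c e, hg d e]
    rw [hr c, hr d, hr e, e3 c c, e3 d c, e3 e c, e3 d d, e3 e d, e3 e e, hq d, hq e, e4 d d,
      e4 e d, e4 e e, hs d e]
    ring
  have h4 : 0 < schur (schur g b) c d d * schur (schur g b) c e e -
      schur (schur g b) c d e ^ 2 := by
    refine pos_of_mul_pos_right (a := g b b * schur g b c c) ?_ (by positivity)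
    rw [h3]
    positivity
  have h5 (x : V) : 0 ≤ schur (schur g b) c x x := by
    have h6 : schur (schur g b) c x x = _ :=
      (inner_normalPart (P b - P a) (P c - P a) (P x - P a) (P x - P a)).symm
    rw [h6]
    exact real_inner_self_nonneg
  -- A zero diagonal entry would make the positive 2×2 minor equal to minus a square.
  refine ⟨h1, h2, (h5 d).lt_of_ne' fun h0 => ?_, (h5 e).lt_of_ne' fun h0 => ?_, h3⟩ <;>
  · rw [h0] at h4
    nlinarith [sq_nonneg (schur (schur g b) c d e)]

end AbstractSimplicialComplex

namespace AbstractSimplicialComplex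

variable {V : Type*}

/-! ### Dihedral angles as functions of the squared edge lengths -/

/-- The squared distance of two vertices, given the squared edge lengths. -/
def sqDist (L : Finset V → ℝ) (x y : V) : ℝ := if x = y then 0 else L {x, y}

theorem sqDist_comm (L : Finset V → ℝ) (x y : V) : sqDist L x y = sqDist L y x := by
  simp only [sqDist, Finset.pair_comm x y, eq_comm]

@[simp] theorem sqDist_self (L : Finset V → ℝ) (x : V) : sqDist L x x = 0 := if_pos rfl

/-- The inner product of the edge vectors from `a` to `x` and `y`, given the squared edge
lengths. -/
def gram (L : Finset V → ℝ) (a x y : V) : ℝ := (sqDist L a x + sqDist L a y - sqDist L x y) / 2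

theorem gram_comm (L : Finset V → ℝ) (a x y : V) : gram L a x y = gram L a y x := by
  rw [gram, gram, sqDist_comm L x y]; ring

/-- The positions `P` of the vertices in `s` have the squared distances given by `L`. -/
def Realizes (L : Finset V → ℝ) (s : Finset V) (P : V → E4) : Prop :=
  ∀ x ∈ s, ∀ y ∈ s, x ≠ y → dist (P x) (P y) ^ 2 = L {x, y}

theorem Realizes.mono {L : Finset V → ℝ} {s r : Finset V} {P : V → E4} (h : Realizes L s P)
    (hr : r ⊆ s) : Realizes L r P :=
  fun x hx y hy => h x (hr hx) y (hr hy)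

theorem Realizes.sqDist_eq {L : Finset V → ℝ} {s : Finset V} {P : V → E4} (h : Realizes L s P)
    {x y : V} (hx : x ∈ s) (hy : y ∈ s) : sqDist L x y = dist (P x) (P y) ^ 2 := by
  rw [sqDist]
  split_ifs with hxy
  · simp [hxy]
  · exact (h x hx y hy hxy).symm

theorem Realizes.inner_eq {L : Finset V → ℝ} {s : Finset V} {P : V → E4} (h : Realizes L s P)
    {a x y : V} (ha : a ∈ s) (hx : x ∈ s) (hy : y ∈ s) :
    inner ℝ (P x - P a) (P y - P a) = gram L a x y := by
  rw [gram, h.sqDist_eq ha hx, h.sqDist_eq ha hy, h.sqDist_eq hx hy,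
    real_inner_eq_norm_mul_self_add_norm_mul_self_sub_norm_sub_mul_self_div_two,
    sub_sub_sub_cancel_right, dist_comm (P a), dist_comm (P a), dist_eq_norm, dist_eq_norm,
    dist_eq_norm]
  ring

/-- The inner products of the components of edge vectors orthogonal to the face `abc`, given the
squared edge lengths. -/
def normalGram (L : Finset V → ℝ) (a b c : V) : V → V → ℝ := schur (schur (gram L a) b) c

theorem normalGram_comm (L : Finset V → ℝ) (a b c x y : V) :
    normalGram L a b c x y = normalGram L a b c y x :=
  schur_comm (schur_comm (gram_comm L a) b) c x y

/-- The dihedral angle at `abc` of the 4-simplex `abcde`, given the squared edge lengths. -/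
def angleFormula (L : Finset V → ℝ) (a b c d e : V) : ℝ :=
  Real.arccos (normalGram L a b c d e /
    (√(normalGram L a b c d d) * √(normalGram L a b c e e)))

theorem schur_congr {ι : Type*} {g g' : ι → ι → ℝ} {s : Set ι}
    (h : ∀ x ∈ s, ∀ y ∈ s, g x y = g' x y) {b : ι} (hb : b ∈ s) :
    ∀ x ∈ s, ∀ y ∈ s, schur g b x y = schur g' b x y := fun x hx y hy => by
  rw [schur, schur, h x hx y hy, h x hx b hb, h y hy b hb, h b hb b hb]

theorem Realizes.schur_eq {L : Finset V → ℝ} {s : Finset V} {P : V → E4} (h : Realizes L s P)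
    {a b x y : V} (ha : a ∈ s) (hb : b ∈ s) (hx : x ∈ s) (hy : y ∈ s) :
    schur (fun x y => (inner ℝ (P x - P a) (P y - P a) : ℝ)) b x y = schur (gram L a) b x y :=
  schur_congr (s := s) (fun _ hx _ hy => h.inner_eq ha hx hy) hb x hx y hy

theorem Realizes.normalGram_eq {L : Finset V → ℝ} {s : Finset V} {P : V → E4} (h : Realizes L s P)
    {a b c x y : V} (ha : a ∈ s) (hb : b ∈ s) (hc : c ∈ s) (hx : x ∈ s) (hy : y ∈ s) :
    schur (schur (fun x y => (inner ℝ (P x - P a) (P y - P a) : ℝ)) b) c x y =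
      normalGram L a b c x y :=
  schur_congr (s := s) (fun _ hx _ hy => h.schur_eq ha hb hx hy) hc x hx y hy

theorem Realizes.inner_normalPart {L : Finset V → ℝ} {s : Finset V} {P : V → E4}
    (h : Realizes L s P) {a b c x y : V} (ha : a ∈ s) (hb : b ∈ s) (hc : c ∈ s) (hx : x ∈ s)
    (hy : y ∈ s) :
    inner ℝ (normalPart (P b - P a) (P c - P a) (P x - P a))
      (normalPart (P b - P a) (P c - P a) (P y - P a)) = normalGram L a b c x y :=
  (AbstractSimplicialComplex.inner_normalPart _ _ _ _).trans (h.normalGram_eq ha hb hc hx hy)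

theorem Realizes.angle_normalPart {L : Finset V → ℝ} {s : Finset V} {P : V → E4}
    (h : Realizes L s P) {a b c d e : V} (ha : a ∈ s) (hb : b ∈ s) (hc : c ∈ s) (hd : d ∈ s)
    (he : e ∈ s) :
    InnerProductGeometry.angle (normalPart (P b - P a) (P c - P a) (P d - P a))
      (normalPart (P b - P a) (P c - P a) (P e - P a)) = angleFormula L a b c d e := by
  rw [InnerProductGeometry.angle, h.inner_normalPart ha hb hc hd he, norm_eq_sqrt_real_inner,
    norm_eq_sqrt_real_inner, h.inner_normalPart ha hb hc hd hd, h.inner_normalPart ha hb hc he he,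
    angleFormula]

theorem span_edges_eq_vectorSpan (P : V → E4) (a b c : V) :
    Submodule.span ℝ {P b - P a, P c - P a} =
      vectorSpan ℝ (P '' (({a, b, c} : Finset V) : Set V)) := by
  rw [vectorSpan_eq_span_vsub_set_right ℝ (p := P a) (by simp)]
  simp [Set.image_insert_eq]

/-- The direction of the plane depends on the vertex set only, and a change of base point adds a
vector of that plane, which the projection kills. -/
theorem normalPart_congr (P : V → E4) {a b c a' b' c' : V}
    (h : ({a, b, c} : Finset V) = {a', b', c'}) (d : V) :
    normalPart (P b' - P a') (P c' - P a') (P d - P a') =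
      normalPart (P b - P a) (P c - P a) (P d - P a) := by
  simp only [normalPart, span_edges_eq_vectorSpan, ← h]
  have h1 : P d - P a' = (P d - P a) + (P a - P a') := by abel
  rw [h1, map_add, add_eq_left]
  apply Submodule.starProjection_orthogonal_apply_eq_zero
  refine vsub_mem_vectorSpan ℝ (Set.mem_image_of_mem P (by simp)) (Set.mem_image_of_mem P ?_)
  rw [h]
  simp

/-- The enumeration hidden in the definition may permute the face, which does not affect the
normals, and may swap the two remaining vertices, which does not affect the angle. Hence the value
chosen by `epsilon` is unambiguous. -/
theorem IsDihedralAngle.eq_angleFormula {L : Finset V → ℝ} {a b c d e : V}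
    (hinj : Function.Injective ![a, b, c, d, e]) {θ : ℝ}
    (h : IsDihedralAngle L {a, b, c} {a, b, c, d, e} θ) : θ = angleFormula L a b c d e := by
  obtain ⟨P, a', b', c', d', e', ht, hs, hL, rfl⟩ := h
  have hP : Realizes L {a, b, c, d, e} P := hL
  rw [normalPart_congr P ht, normalPart_congr P ht]
  have hne (i j : Fin 5) (hij : i ≠ j) : ![a, b, c, d, e] i ≠ ![a, b, c, d, e] j := hinj.ne hij
  have hd : d ∉ ({a, b, c} : Finset V) := by
    simpa using ⟨hne 3 0 (by decide), hne 3 1 (by decide), hne 3 2 (by decide)⟩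
  have he : e ∉ ({a, b, c} : Finset V) := by
    simpa using ⟨hne 4 0 (by decide), hne 4 1 (by decide), hne 4 2 (by decide)⟩
  have hde : d ≠ e := hne 3 4 (by decide)
  have hmem (x : V) : x ∈ ({a', b', c', d', e'} : Finset V) ↔
      x ∈ ({a, b, c} : Finset V) ∨ x = d' ∨ x = e' := by
    rw [ht]; simp [or_assoc]
  have hd' := (hmem d).1 (by rw [← hs]; simp)
  have he' := (hmem e).1 (by rw [← hs]; simp)
  rcases hd'.resolve_left hd with rfl | rfl <;> rcases he'.resolve_left he with rfl | rfl
  · exact absurd rfl hde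
  · exact hP.angle_normalPart (by simp) (by simp) (by simp) (by simp) (by simp)
  · rw [InnerProductGeometry.angle_comm]
    exact hP.angle_normalPart (by simp) (by simp) (by simp) (by simp) (by simp)
  · exact absurd rfl hde

theorem dihedralAngle_eq {L : Finset V → ℝ} {a b c d e : V}
    (hinj : Function.Injective ![a, b, c, d, e]) {P : V → E4}
    (hP : Realizes L {a, b, c, d, e} P) :
    dihedralAngle L {a, b, c} {a, b, c, d, e} = angleFormula L a b c d e :=
  (Classical.epsilon_spec (p := fun θ => IsDihedralAngle L {a, b, c} {a, b, c, d, e} θ)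
    ⟨_, P, a, b, c, d, e, rfl, rfl, hP, rfl⟩).eq_angleFormula hinj

theorem continuous_gram (a x y : V) : Continuous fun L : Finset V → ℝ => gram L a x y := by
  have h (x y : V) : Continuous fun L : Finset V → ℝ => sqDist L x y := by
    unfold sqDist
    split_ifs
    · exact continuous_const
    · exact continuous_apply _
  exact (((h a x).add (h a y)).sub (h x y)).div_const 2

open scoped MatrixOrder Matrix.Norms.L2Operator in
theorem exists_eq_conjTranspose_mul_self {n : Type*} [Fintype n] {A : Matrix n n ℝ}
    (hA : A.PosSemidef) : ∃ B : Matrix n n ℝ, A = B.conjTranspose * B :=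
  CStarAlgebra.nonneg_iff_eq_star_mul_self.mp hA.nonneg

/-- Squared edge lengths close to those of a nondegenerate 4-simplex are realizable. -/
theorem eventually_exists_realizes {L₀ : Finset V → ℝ} {v : Fin 5 → V} (hv : Function.Injective v)
    {P : V → E4} (hP : Realizes L₀ (Finset.univ.image v) P) (hdet : simplexDet (P ∘ v) ≠ 0) :
    ∀ᶠ L in nhds L₀, ∃ P, Realizes L (Finset.univ.image v) P := by
  let G (L : Finset V → ℝ) : Matrix (Fin 4) (Fin 4) ℝ :=
    Matrix.of fun i j => gram L (v 0) (v i.succ) (v j.succ)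
  let q (L : Finset V → ℝ) (x : Fin 4 → ℝ) : ℝ :=
    ∑ i, ∑ j, x i * gram L (v 0) (v i.succ) (v j.succ) * x j
  have hmem (i : Fin 5) : v i ∈ Finset.univ.image v := Finset.mem_image_of_mem v (Finset.mem_univ i)
  have hq : Continuous fun z : (Finset V → ℝ) × (Fin 4 → ℝ) => q z.1 z.2 := by
    refine continuous_finsetSum _ fun i _ => continuous_finsetSum _ fun j _ => ?_
    have := (continuous_gram (v 0) (v i.succ) (v j.succ)).comp
      (continuous_fst (X := Finset V → ℝ) (Y := Fin 4 → ℝ))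
    simp only [Function.comp_def] at this
    fun_prop
  -- At `L₀` the form is the squared norm of a combination of independent edge vectors. Compactness
  -- of the unit sphere then gives positivity on the whole sphere for all `L` near `L₀`, and
  -- homogeneity extends it to all vectors.
  have hpos : ∀ x ∈ Metric.sphere (0 : Fin 4 → ℝ) 1, ∀ᶠ z in nhds (L₀, x), 0 < q z.1 z.2 := by
    intro x hx
    refine hq.continuousAt.eventually_const_lt ?_
    have h1 : q L₀ x = inner ℝ (∑ i, x i • (P (v i.succ) - P (v 0)))
        (∑ i, x i • (P (v i.succ) - P (v 0))) := by
      simp only [q, sum_inner, inner_sum, real_inner_smul_left, real_inner_smul_right,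
        hP.inner_eq (hmem 0) (hmem _) (hmem _)]
      exact Finset.sum_congr rfl fun i _ => Finset.sum_congr rfl fun j _ => by
        rw [gram_comm]; ring
    show 0 < q L₀ x
    rw [h1]
    refine real_inner_self_pos.2 fun h0 => ?_
    have h2 := Fintype.linearIndependent_iff.1 ((simplexDet_ne_zero_iff _).1 hdet) x h0
    have h3 : x = 0 := funext h2
    simp [h3] at hx
  have hev := (isCompact_sphere (0 : Fin 4 → ℝ) 1).eventually_forall_of_forall_eventually
    (x₀ := L₀) (P := fun L x => 0 < q L x) hpos
  filter_upwards [hev] with L hL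
  have hG : (G L).PosSemidef := by
    refine Matrix.PosSemidef.of_dotProduct_mulVec_nonneg ?_ fun x => ?_
    · ext i j
      simp [G, gram_comm L (v 0) (v j.succ)]
    · have h1 : star x ⬝ᵥ (G L).mulVec x = q L x := by
        simp only [dotProduct, Matrix.mulVec, Finset.mul_sum, q, G, Matrix.of_apply, star_trivial,
          mul_assoc]
      rw [h1]
      rcases eq_or_ne x 0 with rfl | hx
      · simp [q]
      · have h2 := hL (‖x‖⁻¹ • x) (by simp [norm_smul, hx])
        have h3 : q L x = ‖x‖ ^ 2 * q L (‖x‖⁻¹ • x) := by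
          have h4 : ‖x‖ ≠ 0 := norm_ne_zero_iff.2 hx
          simp only [q, Finset.mul_sum, Pi.smul_apply, smul_eq_mul]
          refine Finset.sum_congr rfl fun i _ => Finset.sum_congr rfl fun j _ => ?_
          field_simp
        rw [h3]
        positivity
  obtain ⟨B, hB⟩ : ∃ B : Matrix (Fin 4) (Fin 4) ℝ, G L = B.conjTranspose * B :=
    exists_eq_conjTranspose_mul_self hG
  -- The columns of a factor `B` of the Gram matrix serve as the edge vectors from the origin.
  let Q : Fin 5 → E4 := Fin.cons 0 fun i => WithLp.toLp 2 fun k => B k i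
  have hin (i j : Fin 5) : (inner ℝ (Q i) (Q j) : ℝ) = gram L (v 0) (v i) (v j) := by
    refine Fin.cases ?_ (fun i => ?_) i
    · simp [Q, gram]
    · refine Fin.cases ?_ (fun j => ?_) j
      · simp [Q, gram, sqDist_comm L (v 0)]
      · have := congrFun (congrFun hB i) j
        simp only [G, Matrix.of_apply, Matrix.mul_apply] at this
        rw [this]
        simp [Q, PiLp.inner_apply, mul_comm]
  refine ⟨Function.extend v Q 0, ?_⟩
  intro x hx y hy hxy
  obtain ⟨i, -, rfl⟩ := Finset.mem_image.1 hx
  obtain ⟨j, -, rfl⟩ := Finset.mem_image.1 hy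
  rw [hv.extend_apply, hv.extend_apply, dist_eq_norm, norm_sub_sq_real,
    ← real_inner_self_eq_norm_sq, ← real_inner_self_eq_norm_sq, hin, hin, hin, gram, gram, gram,
    sqDist_self, sqDist_self]
  have h : sqDist L (v i) (v j) = L {v i, v j} := if_neg hxy
  linarith

end AbstractSimplicialComplex

namespace AbstractSimplicialComplex

variable {V : Type*}

/-! ### The derivative of the sum of the three signed dihedral angles at a 2-face -/

/-- The derivative of `schur g b` when `g` varies with velocity `g'`. -/
def schurDeriv {ι : Type*} (g g' : ι → ι → ℝ) (b x y : ι) : ℝ :=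
  g' x y - (g' x b * g y b + g x b * g' y b) / g b b + g x b * g y b * g' b b / g b b ^ 2

theorem hasDerivAt_schur {ι : Type*} {g : ℝ → ι → ι → ℝ} {g' : ι → ι → ℝ} {t : ℝ}
    (hg : ∀ x y, HasDerivAt (fun l => g l x y) (g' x y) t) {b : ι} (hb : g t b b ≠ 0) (x y : ι) :
    HasDerivAt (fun l => schur (g l) b x y) (schurDeriv (g t) g' b x y) t := by
  refine ((hg x y).sub (((hg x b).mul (hg y b)).div (hg b b) hb)).congr_deriv ?_
  rw [schurDeriv]
  simp only [Pi.mul_apply]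
  field_simp
  ring

theorem schurDeriv_comm {ι : Type*} {g g' : ι → ι → ℝ} (hg' : ∀ x y, g' x y = g' y x) (b x y : ι) :
    schurDeriv g g' b x y = schurDeriv g g' b y x := by
  rw [schurDeriv, schurDeriv, hg' x y]
  ring

/-- Subtract from the relation for column `y` the multiple `g y b / g b b` of the relation for
column `b`: the terms with index `b` cancel. Kernel vectors thus stay in the kernel after
elimination. -/
theorem sum_mul_schur {ι : Type*} {g : ι → ι → ℝ} (hg : ∀ x y, g x y = g y x) {S : Finset ι} {b : ι}
    (hbS : b ∉ S) (hb : g b b ≠ 0) {w : ι → ℝ} {y : ι} (hy : ∑ x ∈ insert b S, w x * g x y = 0)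
    (hker : ∑ x ∈ insert b S, w x * g x b = 0) : ∑ x ∈ S, w x * schur g b x y = 0 := by
  rw [Finset.sum_insert hbS] at hy hker
  have h : ∑ x ∈ S, w x * schur g b x y =
      ∑ x ∈ S, w x * g x y - (∑ x ∈ S, w x * g x b) * (g y b / g b b) := by
    rw [Finset.sum_mul, ← Finset.sum_sub_distrib]
    exact Finset.sum_congr rfl fun x _ => by rw [schur]; ring
  rw [h, eq_neg_of_add_eq_zero_right hy, eq_neg_of_add_eq_zero_right hker, hg y b]
  field_simp
  ring

/-- On the kernel of `g`, eliminating an index does not change the quadratic form of the velocity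
of `g`. -/
theorem sum_schurDeriv {ι : Type*} {g g' : ι → ι → ℝ} (hg' : ∀ x y, g' x y = g' y x)
    {S : Finset ι} {b : ι} (hbS : b ∉ S) (hb : g b b ≠ 0) {w : ι → ℝ}
    (hker : ∑ x ∈ insert b S, w x * g x b = 0) :
    ∑ x ∈ S, ∑ y ∈ S, w x * w y * schurDeriv g g' b x y =
      ∑ x ∈ insert b S, ∑ y ∈ insert b S, w x * w y * g' x y := by
  rw [Finset.sum_insert hbS] at hker
  set A := ∑ x ∈ S, w x * g' x b with hA
  have h1 : ∑ x ∈ S, w x * g x b = -(w b * g b b) := eq_neg_of_add_eq_zero_right hker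
  -- The corrections contain only the sum `∑ w x * g x b` over `S`. Replacing it by `-(w b * g b b)`
  -- turns them into exactly the missing terms with index `b`.
  have h2 : ∑ x ∈ S, ∑ y ∈ S, w x * w y * schurDeriv g g' b x y =
      ∑ x ∈ S, ∑ y ∈ S, w x * w y * g' x y
        - 2 * (A * ∑ x ∈ S, w x * g x b) / g b b
        + (∑ x ∈ S, w x * g x b) * (∑ x ∈ S, w x * g x b) * g' b b / g b b ^ 2 := by
    have h3 : 2 * (A * ∑ x ∈ S, w x * g x b) =
        A * (∑ x ∈ S, w x * g x b) + (∑ x ∈ S, w x * g x b) * A := by ring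
    rw [h3, hA, Finset.sum_mul_sum, Finset.sum_mul_sum, Finset.sum_mul_sum,
      ← Finset.sum_add_distrib, Finset.sum_div, Finset.sum_mul, Finset.sum_div,
      ← Finset.sum_sub_distrib, ← Finset.sum_add_distrib]
    refine Finset.sum_congr rfl fun x _ => ?_
    rw [← Finset.sum_add_distrib, Finset.sum_div, Finset.sum_mul, Finset.sum_div,
      ← Finset.sum_sub_distrib, ← Finset.sum_add_distrib]
    refine Finset.sum_congr rfl fun y _ => ?_
    rw [schurDeriv]
    ring
  have h4 : ∑ y ∈ S, w b * w y * g' b y = w b * A := by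
    rw [hA, Finset.mul_sum]
    exact Finset.sum_congr rfl fun x _ => by rw [hg' b x]; ring
  have h5 : ∑ x ∈ S, ∑ y ∈ insert b S, w x * w y * g' x y =
      w b * A + ∑ x ∈ S, ∑ y ∈ S, w x * w y * g' x y := by
    rw [hA, Finset.mul_sum, ← Finset.sum_add_distrib]
    exact Finset.sum_congr rfl fun x _ => by rw [Finset.sum_insert hbS]; ring
  rw [h2, h1, Finset.sum_insert hbS, Finset.sum_insert hbS, h4, h5]
  field_simp
  ring

/-- `sqDist` is linear in the lengths, so its velocity is its own value at the indicator `Pi.single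
e 1` of the edge. -/
theorem hasDerivAt_sqDist (L : Finset V → ℝ) (e : Finset V) (l : ℝ) (x y : V) :
    HasDerivAt (fun l => sqDist (Function.update L e l) x y) (sqDist (Pi.single e 1) x y) l := by
  unfold sqDist
  split_ifs
  · exact hasDerivAt_const _ _
  · by_cases h : ({x, y} : Finset V) = e
    · subst h
      simpa using hasDerivAt_id' l
    · simpa [h] using hasDerivAt_const l (L {x, y})

theorem hasDerivAt_gram (L : Finset V → ℝ) (e : Finset V) (l : ℝ) (a x y : V) :
    HasDerivAt (fun l => gram (Function.update L e l) a x y) (gram (Pi.single e 1) a x y) l :=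
  (((hasDerivAt_sqDist L e l a x).add (hasDerivAt_sqDist L e l a y)).sub
    (hasDerivAt_sqDist L e l x y)).div_const 2

/-- Polarization: the terms with a distance from `a` contain the factor `∑ w = 0`. The index `a` can
be added freely, since `gram L a a y = 0`. -/
theorem sum_mul_gram (L : Finset V → ℝ) {a : V} {S : Finset V} (ha : a ∉ S) {w : V → ℝ}
    (hw : ∑ x ∈ insert a S, w x = 0) :
    ∑ x ∈ S, ∑ y ∈ S, w x * w y * gram L a x y =
      -(∑ x ∈ insert a S, ∑ y ∈ insert a S, w x * w y * sqDist L x y) / 2 := by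
  have h0 (y : V) : gram L a a y = 0 := by rw [gram, sqDist_self]; ring
  have h1 : ∑ x ∈ S, ∑ y ∈ S, w x * w y * gram L a x y =
      ∑ x ∈ insert a S, ∑ y ∈ insert a S, w x * w y * gram L a x y := by
    rw [Finset.sum_insert ha]
    simp only [h0, mul_zero, Finset.sum_const_zero, zero_add]
    refine Finset.sum_congr rfl fun x _ => ?_
    rw [Finset.sum_insert ha, gram_comm, h0, mul_zero, zero_add]
  have h2 : ∑ x ∈ insert a S, ∑ y ∈ insert a S, w x * w y * gram L a x y =
      ((∑ x ∈ insert a S, w x * sqDist L a x) * (∑ y ∈ insert a S, w y) +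
        (∑ x ∈ insert a S, w x) * (∑ y ∈ insert a S, w y * sqDist L a y) -
        ∑ x ∈ insert a S, ∑ y ∈ insert a S, w x * w y * sqDist L x y) / 2 := by
    rw [Finset.sum_mul_sum, Finset.sum_mul_sum, ← Finset.sum_add_distrib,
      ← Finset.sum_sub_distrib, Finset.sum_div]
    refine Finset.sum_congr rfl fun x _ => ?_
    rw [← Finset.sum_add_distrib, ← Finset.sum_sub_distrib, Finset.sum_div]
    exact Finset.sum_congr rfl fun y _ => by rw [gram]; ring
  rw [h1, h2, hw]
  ring

/-- The sine of the angle is √(yz - x²) / (√y √z), so the denominator of the cosine cancels from the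
derivative. -/
theorem hasDerivAt_arccos_div {x y z : ℝ → ℝ} {x' y' z' t : ℝ} (hx : HasDerivAt x x' t)
    (hy : HasDerivAt y y' t) (hz : HasDerivAt z z' t) (hy0 : 0 < y t) (hz0 : 0 < z t)
    (hD : 0 < y t * z t - x t ^ 2) :
    HasDerivAt (fun l => Real.arccos (x l / (√(y l) * √(z l))))
      (-(x' - x t / 2 * (y' / y t + z' / z t)) / √(y t * z t - x t ^ 2)) t := by
  have hsy : 0 < √(y t) := Real.sqrt_pos.2 hy0
  have hsz : 0 < √(z t) := Real.sqrt_pos.2 hz0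
  have hy2 : √(y t) ^ 2 = y t := Real.sq_sqrt hy0.le
  have hz2 : √(z t) ^ 2 = z t := Real.sq_sqrt hz0.le
  have h1 : 1 - (x t / (√(y t) * √(z t))) ^ 2 = (y t * z t - x t ^ 2) / (√(y t) * √(z t)) ^ 2 := by
    have : (√(y t) * √(z t)) ^ 2 = y t * z t := by rw [mul_pow, hy2, hz2]
    rw [div_pow, this]
    field_simp
  have h2 : 0 < 1 - (x t / (√(y t) * √(z t))) ^ 2 := by rw [h1]; positivity
  have h3 : √(1 - (x t / (√(y t) * √(z t))) ^ 2) =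
      √(y t * z t - x t ^ 2) / (√(y t) * √(z t)) := by
    rw [h1, Real.sqrt_div' _ (by positivity), Real.sqrt_sq (by positivity)]
  have hDs : 0 < √(y t * z t - x t ^ 2) := Real.sqrt_pos.2 hD
  have h4 := (Real.hasDerivAt_arccos (x := x t / (√(y t) * √(z t)))
    (fun h => by rw [h] at h2; norm_num at h2) (fun h => by rw [h] at h2; norm_num at h2)).comp t
    (hx.div ((hy.sqrt hy0.ne').mul (hz.sqrt hz0.ne')) (mul_pos hsy hsz).ne')
  refine h4.congr_deriv ?_
  rw [h3]
  simp only [Pi.mul_apply]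
  have e1 : y' / y t = y' / √(y t) ^ 2 := by rw [hy2]
  have e2 : z' / z t = z' / √(z t) ^ 2 := by rw [hz2]
  rw [e1, e2]
  generalize √(y t) = u at *
  generalize √(z t) = v at *
  generalize √(y t * z t - x t ^ 2) = r at *
  field_simp

/-- The velocity of the entries of `normalGram` when the squared length of the edge `e` varies. -/
def normalGramDeriv (L : Finset V → ℝ) (a b c : V) (e : Finset V) : V → V → ℝ :=
  schurDeriv (schur (gram L a) b) (schurDeriv (gram L a) (gram (Pi.single e 1) a) b) c

theorem hasDerivAt_normalGram {L : Finset V → ℝ} {a b c : V} (e : Finset V)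
    (hb : gram L a b b ≠ 0) (hc : schur (gram L a) b c c ≠ 0) (x y : V) :
    HasDerivAt (fun l => normalGram (Function.update L e l) a b c x y)
      (normalGramDeriv L a b c e x y) (L e) := by
  have hL : Function.update L e (L e) = L := Function.update_eq_self e L
  have h1 (x y : V) := hasDerivAt_gram L e (L e) a x y
  have h2 (x y : V) := hasDerivAt_schur (t := L e)
    (g := fun l => gram (Function.update L e l) a) h1 (b := b) (by rwa [hL]) x y
  have h3 := hasDerivAt_schur (t := L e)
    (g := fun l => schur (gram (Function.update L e l) a) b) h2 (b := c) (by simpa only [hL]) x y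
  simp only [hL] at h3
  exact h3

theorem normalGramDeriv_comm (L : Finset V → ℝ) (a b c : V) (e : Finset V) (x y : V) :
    normalGramDeriv L a b c e x y = normalGramDeriv L a b c e y x :=
  schurDeriv_comm (schurDeriv_comm (gram_comm _ a) b) c x y

/-- Polarization followed by the eliminations of `b` and `c`, with `w` in the kernel at each stage.
The right side does not depend on which of the vertices form the face; this is what separates the
edge from the face in the final formula. -/
theorem sum_normalGramDeriv {L : Finset V → ℝ} {a b c : V} {S : Finset V}
    (ha : a ∉ insert b (insert c S)) (hb : b ∉ insert c S) (hc : c ∉ S)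
    (hb0 : gram L a b b ≠ 0) (hc0 : schur (gram L a) b c c ≠ 0) {w : V → ℝ}
    (hw : ∑ x ∈ insert a (insert b (insert c S)), w x = 0)
    (hker : ∀ y ∈ insert b (insert c S), ∑ x ∈ insert b (insert c S), w x * gram L a x y = 0)
    (e : Finset V) :
    (∀ y ∈ S, ∑ x ∈ S, w x * normalGram L a b c x y = 0) ∧
    ∑ x ∈ S, ∑ y ∈ S, w x * w y * normalGramDeriv L a b c e x y =
      -(∑ x ∈ insert a (insert b (insert c S)), ∑ y ∈ insert a (insert b (insert c S)),
        w x * w y * sqDist (Pi.single e 1) x y) / 2 := by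
  have h1 (y : V) (hy : y ∈ insert c S) : ∑ x ∈ insert c S, w x * schur (gram L a) b x y = 0 :=
    sum_mul_schur (gram_comm L a) hb hb0 (hker y (Finset.mem_insert_of_mem hy))
      (hker b (Finset.mem_insert_self _ _))
  have hcS : c ∈ insert c S := Finset.mem_insert_self _ _
  refine ⟨fun y hy => sum_mul_schur (schur_comm (gram_comm L a) b) hc hc0
    (h1 y (Finset.mem_insert_of_mem hy)) (h1 c hcS), ?_⟩
  rw [← sum_mul_gram _ ha hw, ← sum_schurDeriv (gram_comm _ a) hb hb0
    (hker b (Finset.mem_insert_self _ _)), ← sum_schurDeriv (schurDeriv_comm (gram_comm _ a) b) hc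
    hc0 (h1 c hcS)]
  rfl

/-- The sign of the volume in the deficit angle compensates for the absolute value left by the
square root; the derivative becomes rational in the weights, up to the area factor. -/
theorem sign_mul_div_abs {x W k : ℝ} (hx : x ≠ 0) : Real.sign x * (k / (|x| / W)) = W * k / x := by
  rcases lt_or_gt_of_ne hx with h | h
  · rw [Real.sign_of_neg h, abs_of_neg h, div_div_eq_mul_div, div_neg]; ring
  · rw [Real.sign_of_pos h, abs_of_pos h, div_div_eq_mul_div]; ring

/-- The sum of the signed dihedral angles at `abc` of the three 4-simplices spanned by `abc` and two
of the points `d`, `e`, `f`: its derivatives with respect to the squared edge lengths. -/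
theorem hasDerivAt_signed_angle_sum {L : Finset V → ℝ} {P : V → E4} {a b c d e f : V}
    (hinj : Function.Injective ![a, b, c, d, e, f]) (hP : Realizes L {a, b, c, d, e, f} P)
    {w : V → ℝ} (hw : ∑ x ∈ {a, b, c, d, e, f}, w x = 0)
    (hwP : ∑ x ∈ {a, b, c, d, e, f}, w x • P x = 0)
    (hd : w d ≠ 0) (he : w e ≠ 0) (hf : w f ≠ 0)
    (hfd : simplexDet (P ∘ ![a, b, c, d, e]) ^ 2 = w f ^ 2)
    (hdd : simplexDet (P ∘ ![a, b, c, e, f]) ^ 2 = w d ^ 2)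
    (hed : simplexDet (P ∘ ![a, b, c, d, f]) ^ 2 = w e ^ 2) (s : Finset V) :
    HasDerivAt (fun l =>
        Real.sign (w d) * angleFormula (Function.update L s l) a b c e f +
        Real.sign (w e) * angleFormula (Function.update L s l) a b c d f +
        Real.sign (w f) * angleFormula (Function.update L s l) a b c d e)
      (√(gram L a b b * schur (gram L a) b c c) *
        (∑ x ∈ {a, b, c, d, e, f}, ∑ y ∈ {a, b, c, d, e, f},
          w x * w y * sqDist (Pi.single s 1) x y) / (4 * (w d * w e * w f))) (L s) := by
  have hne (i j : Fin 6) (hij : i ≠ j) :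
    ![a, b, c, d, e, f] i ≠ ![a, b, c, d, e, f] j := hinj.ne hij
  have hab : a ≠ b := hne 0 1 (by decide)
  have hac : a ≠ c := hne 0 2 (by decide)
  have had : a ≠ d := hne 0 3 (by decide)
  have hae : a ≠ e := hne 0 4 (by decide)
  have haf : a ≠ f := hne 0 5 (by decide)
  have hbc : b ≠ c := hne 1 2 (by decide)
  have hbd : b ≠ d := hne 1 3 (by decide)
  have hbe : b ≠ e := hne 1 4 (by decide)
  have hbf : b ≠ f := hne 1 5 (by decide)
  have hcd : c ≠ d := hne 2 3 (by decide)
  have hce : c ≠ e := hne 2 4 (by decide)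
  have hcf : c ≠ f := hne 2 5 (by decide)
  have hde : d ≠ e := hne 3 4 (by decide)
  have hdf : d ≠ f := hne 3 5 (by decide)
  have hef : e ≠ f := hne 4 5 (by decide)
  have key {x y z : V} (hx : x ∈ ({a, b, c, d, e, f} : Finset V))
      (hy : y ∈ ({a, b, c, d, e, f} : Finset V)) (hz : w z ≠ 0)
      (h : simplexDet (P ∘ ![a, b, c, x, y]) ^ 2 = w z ^ 2) :
      0 < gram L a b b ∧ 0 < schur (gram L a) b c c ∧ 0 < normalGram L a b c x x ∧
        0 < normalGram L a b c y y ∧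
        gram L a b b * schur (gram L a) b c c * (normalGram L a b c x x * normalGram L a b c y y -
          normalGram L a b c x y ^ 2) = w z ^ 2 := by
    have h0 : simplexDet (P ∘ ![a, b, c, x, y]) ≠ 0 := fun h0 => by
      rw [h0] at h
      exact hz (pow_eq_zero_iff two_ne_zero |>.1 (h.symm.trans (zero_pow two_ne_zero)))
    have h1 := schur_simplexDet P h0
    rw [h] at h1
    have ha : a ∈ ({a, b, c, d, e, f} : Finset V) := by simp
    have hb : b ∈ ({a, b, c, d, e, f} : Finset V) := by simp
    have hc : c ∈ ({a, b, c, d, e, f} : Finset V) := by simp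
    simpa only [hP.inner_eq ha hb hb, hP.schur_eq ha hb hc hc, hP.normalGram_eq ha hb hc hx hx,
      hP.normalGram_eq ha hb hc hy hy, hP.normalGram_eq ha hb hc hx hy] using h1
  obtain ⟨hb0, hc0, hMd, hMe, hDf⟩ := key (by simp) (by simp) hf hfd
  obtain ⟨-, -, -, hMf, hDd⟩ := key (by simp) (by simp) hd hdd
  obtain ⟨-, -, -, -, hDe⟩ := key (by simp) (by simp) he hed
  set W2 := gram L a b b * schur (gram L a) b c c with hW2
  have hW2pos : 0 < W2 := mul_pos hb0 hc0
  -- Because `∑ w = 0`, the affine dependency is a linear dependency of the edge vectors from `a`;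
  -- pair it with `P y - P a`.
  have hker (y : V) (hy : y ∈ ({b, c, d, e, f} : Finset V)) :
      ∑ x ∈ {b, c, d, e, f}, w x * gram L a x y = 0 := by
    have ha : a ∉ ({b, c, d, e, f} : Finset V) := by simp [*]
    have h1 : ∑ x ∈ {b, c, d, e, f}, w x • (P x - P a) = 0 := by
      have h2 : ∑ x ∈ {a, b, c, d, e, f}, w x • (P x - P a) = 0 := by
        simp only [smul_sub]
        rw [Finset.sum_sub_distrib, hwP, ← Finset.sum_smul, hw, zero_smul, sub_zero]
      rwa [Finset.sum_insert ha, sub_self, smul_zero, zero_add] at h2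
    have h3 := congrArg (fun z : E4 => (inner ℝ z (P y - P a) : ℝ)) h1
    simp only [sum_inner, inner_zero_left, real_inner_smul_left] at h3
    refine (Finset.sum_congr rfl fun x hx => ?_).trans h3
    rw [hP.inner_eq (by simp) (Finset.mem_insert_of_mem hx) (Finset.mem_insert_of_mem hy)]
  obtain ⟨hM, hQ⟩ := sum_normalGramDeriv (S := {d, e, f}) (by simp [*]) (by simp [*]) (by simp [*])
    hb0.ne' hc0.ne' hw hker s
  have hder := hasDerivAt_normalGram (L := L) (a := a) s hb0.ne' hc0.ne'
  have hL : Function.update L s (L s) = L := Function.update_eq_self s L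
  have term {x y z : V} (hx : 0 < normalGram L a b c x x) (hy : 0 < normalGram L a b c y y)
      (hz : w z ≠ 0)
      (h : W2 * (normalGram L a b c x x * normalGram L a b c y y -
          normalGram L a b c x y ^ 2) = w z ^ 2) :
      HasDerivAt (fun l => Real.sign (w z) * angleFormula (Function.update L s l) a b c x y)
        (√W2 * (-(normalGramDeriv L a b c s x y - normalGram L a b c x y / 2 *
          (normalGramDeriv L a b c s x x / normalGram L a b c x x +
            normalGramDeriv L a b c s y y / normalGram L a b c y y))) / w z) (L s) := by
    -- `W2` is the Gram determinant of the face, four times its squared area, and the 2×2 minor of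
    -- the normals is the squared determinant of the 4-simplex divided by it.
    have hD : normalGram L a b c x x * normalGram L a b c y y - normalGram L a b c x y ^ 2 =
        w z ^ 2 / W2 := by rw [← h]; field_simp
    have hpos : 0 < w z ^ 2 / W2 := by positivity
    have h1 := hasDerivAt_arccos_div (hder x y) (hder x x) (hder y y) (by rwa [hL]) (by rwa [hL])
      (by rw [hL, hD]; exact hpos)
    rw [hL, hD, Real.sqrt_div (sq_nonneg _), Real.sqrt_sq_eq_abs] at h1
    exact (h1.const_mul (Real.sign (w z))).congr_deriv (sign_mul_div_abs hz)
  refine (((term hMe hMf hd hDd).add (term hMd hMf he hDe)).add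
    (term hMd hMe hf hDf)).congr_deriv ?_
  have hQ' : ∑ x ∈ {a, b, c, d, e, f}, ∑ y ∈ {a, b, c, d, e, f},
      w x * w y * sqDist (Pi.single s 1) x y = -2 * ∑ x ∈ {d, e, f}, ∑ y ∈ {d, e, f},
        w x * w y * normalGramDeriv L a b c s x y := by rw [hQ]; ring
  have hdS : d ∉ ({e, f} : Finset V) := by simp [*]
  have heS : e ∉ ({f} : Finset V) := by simp [*]
  simp only [Finset.sum_insert hdS, Finset.sum_insert heS, Finset.sum_singleton] at hM hQ'
  have hMd' := hM d (by simp)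
  have hMe' := hM e (by simp)
  have hMf' := hM f (by simp)
  rw [hQ', normalGramDeriv_comm L a b c s e d, normalGramDeriv_comm L a b c s f d,
    normalGramDeriv_comm L a b c s f e]
  rw [normalGram_comm L a b c f d, normalGram_comm L a b c e d] at hMd'
  rw [normalGram_comm L a b c f e] at hMe'
  generalize normalGram L a b c = M at *
  generalize normalGramDeriv L a b c s = M' at *
  -- Each diagonal velocity such as `M' d d` occurs in two of the three angles, with coefficients
  -- off the diagonal of `M`. The row of `M w = 0` through that diagonal entry combines them into `w
  -- d / (w e * w f)`, as the quadratic form in `w` requires.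
  have eliminate {mx my mz u x y : ℝ} (hz : mz ≠ 0) (hx : x ≠ 0) (hy : y ≠ 0)
      (h : u * mz + x * mx + y * my = 0) : mx / mz / y + my / mz / x = -(u / (x * y)) := by
    field_simp
    linear_combination h
  have hEd := eliminate hMd.ne' he hf ((add_assoc _ _ _).trans hMd')
  have hEe := eliminate (u := w e) (mx := M d e) (my := M e f) hMe.ne' hd hf
    (by linear_combination hMe')
  have hEf := eliminate (u := w f) (mx := M d f) (my := M e f) hMf.ne' hd he
    (by linear_combination hMf')
  have hR {m1 m2 m3 m4 m5 m6 : ℝ} :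
      √W2 * (-2 * (w d * w d * m1 + (w d * w e * m2 + w d * w f * m3) +
        (w e * w d * m2 + (w e * w e * m4 + w e * w f * m5) +
          (w f * w d * m3 + (w f * w e * m5 + w f * w f * m6))))) / (4 * (w d * w e * w f)) =
      -√W2 * (m1 * (w d / (w e * w f)) / 2 + m4 * (w e / (w d * w f)) / 2 +
        m6 * (w f / (w d * w e)) / 2 + m2 / w f + m3 / w e + m5 / w d) := by
    field_simp
    ring
  rw [hR]
  linear_combination (√W2 / 2 * M' d d) * hEd + (√W2 / 2 * M' e e) * hEe +
    (√W2 / 2 * M' f f) * hEf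

end AbstractSimplicialComplex

namespace AbstractSimplicialComplex

variable {V : Type*} {K : AbstractSimplicialComplex V} {v₀ : V}

/-! ### Lifts to the universal cover -/

theorem PathClass.comp_assoc {v w x y : V} (p : K.PathClass v w) (q : K.PathClass w x)
    (r : K.PathClass x y) : (p.comp q).comp r = p.comp (q.comp r) := by
  induction p using Quotient.inductionOn
  induction q using Quotient.inductionOn
  induction r using Quotient.inductionOn
  exact congrArg PathClass.mk (SimpleGraph.Walk.append_assoc _ _ _).symm

theorem PathClass.comp_nil {v w : V} (p : K.PathClass v w) : p.comp (.mk .nil) = p := by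
  induction p using Quotient.inductionOn
  exact congrArg PathClass.mk (SimpleGraph.Walk.append_nil _)

theorem PathClass.reverse_comp {v w : V} (p : K.PathClass v w) : p.reverse.comp p = .mk .nil := by
  induction p using Quotient.inductionOn
  exact Quotient.sound (s := K.homotopySetoid w w) (Homotopic.reverse_append _)

theorem PathClass.mk_eq {v w : V} {p q : K.skeleton.Walk v w} (h : Homotopic K p q) :
    PathClass.mk p = .mk q := Quotient.sound (s := K.homotopySetoid v w) h

/-- For paths `p` and `q` with the same end, the deck transformation is the loop `q` followed by the
reverse of `p`. -/
theorem CoverVertex.exists_act {x y : K.CoverVertex v₀} (h : x.1 = y.1) :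
    ∃ g : K.EdgePathGroup v₀, x.act g = y := by
  obtain ⟨w, p⟩ := x
  obtain ⟨w', q⟩ := y
  obtain rfl : w = w' := h
  refine ⟨q.comp p.reverse, Sigma.ext rfl (heq_of_eq ?_)⟩
  show (q.comp p.reverse).comp p = q
  rw [PathClass.comp_assoc, PathClass.reverse_comp, PathClass.comp_nil]

theorem CoverVertex.exists_over (h : K.skeleton.Connected) (w : V) :
    ∃ x : K.CoverVertex v₀, x.1 = w :=
  (h.preconnected v₀ w).elim fun p => ⟨⟨w, .mk p⟩, rfl⟩

theorem CoverVertex.step_act (g : K.EdgePathGroup v₀) (x : K.CoverVertex v₀) {w : V}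
    (h : K.skeleton.Adj x.1 w) : (x.act g).step h = (x.step h).act g :=
  Sigma.ext rfl (heq_of_eq (PathClass.comp_assoc _ _ _))

/-- Any two vertices in `X` are joined by an edge, and any three of them span a null-homotopic
triangle. -/
structure Coherent (K : AbstractSimplicialComplex V) (X : Finset V) : Prop where
  adj : ∀ p ∈ X, ∀ q ∈ X, p ≠ q → K.skeleton.Adj p q
  homotopic : ∀ p ∈ X, ∀ q ∈ X, ∀ w ∈ X, ∀ (h₁ : K.skeleton.Adj p q) (h₂ : K.skeleton.Adj q w)
    (h₃ : K.skeleton.Adj p w), Homotopic K (.cons h₁ (.cons h₂ .nil)) (.cons h₃ .nil)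

theorem Coherent.mono {X Y : Finset V} (h : K.Coherent X) (hY : Y ⊆ X) : K.Coherent Y :=
  ⟨fun p hp q hq => h.adj p (hY hp) q (hY hq),
    fun p hp q hq w hw => h.homotopic p (hY hp) q (hY hq) w (hY hw)⟩

theorem face_subset {s r : Finset V} (hs : s ∈ K.faces) (hr : r ⊆ s) (hne : r.Nonempty) :
    r ∈ K.faces := (K.isRelLowerSet_faces hs).2 hr hne

theorem coherent_of_mem_faces {X : Finset V} (hX : X ∈ K.faces) : K.Coherent X := by
  refine ⟨fun p hp q hq hpq => ⟨hpq, face_subset hX ?_ ⟨p, by simp⟩⟩,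
    fun p hp q hq w hw h₁ h₂ h₃ => .triangle h₁ h₂ h₃ (face_subset hX ?_ ⟨p, by simp⟩) _⟩
  · simp [Finset.insert_subset_iff, hp, hq]
  · simp [Finset.insert_subset_iff, hp, hq, hw]

theorem exists_perm_of_image_eq {n : ℕ} {v v' : Fin n → V} (hv' : Function.Injective v')
    (h : Finset.univ.image v' = Finset.univ.image v) : ∃ σ : Equiv.Perm (Fin n), v' = v ∘ σ := by
  have h1 (i : Fin n) : ∃ j, v j = v' i := by
    have := Finset.mem_image_of_mem v' (Finset.mem_univ i)
    rw [h] at this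
    simpa using this
  choose f hf using h1
  have hinj : Function.Injective f := fun i j hij => hv' (by rw [← hf, ← hf, hij])
  exact ⟨Equiv.ofBijective f (Finite.injective_iff_bijective.1 hinj), funext fun i => (hf i).symm⟩

namespace Placement

variable (D : K.Placement v₀)

theorem place_act (g : K.EdgePathGroup v₀) (x : K.CoverVertex v₀) (w : V) :
    D.place (x.act g) w = D.hol g (D.place x w) := by
  by_cases h : K.skeleton.Adj x.1 w
  · have h' : K.skeleton.Adj (x.act g).1 w := h
    rw [place, place, dif_pos h, dif_pos h', ← D.equivariant, ← CoverVertex.step_act]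
  · have h' : ¬ K.skeleton.Adj (x.act g).1 w := h
    rw [place, place, dif_neg h, dif_neg h', D.equivariant]

/-- On a coherent set the lift does not depend on the vertex it is based at: going to `w` through
`q` is homotopic to going there directly, by a backtracking or a null-homotopic triangle. -/
theorem place_step {X : Finset V} (hX : K.Coherent X) {x : K.CoverVertex v₀} (hx : x.1 ∈ X) {q : V}
    (h : K.skeleton.Adj x.1 q) (hq : q ∈ X) {w : V} (hw : w ∈ X) :
    D.place (x.step h) w = D.place x w := by
  obtain ⟨p, c⟩ := x
  change p ∈ X at hx
  change K.skeleton.Adj p q at h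
  rcases eq_or_ne w q with rfl | hwq
  · have h1 : ¬ K.skeleton.Adj (CoverVertex.step ⟨p, c⟩ h : K.CoverVertex v₀).1 w :=
      K.skeleton.loopless.irrefl w
    unfold place
    rw [dif_neg h1, dif_pos h]
  have hqw : K.skeleton.Adj (CoverVertex.step ⟨p, c⟩ h : K.CoverVertex v₀).1 w :=
    hX.adj q hq w hw hwq.symm
  rcases eq_or_ne w p with rfl | hwp
  · have h1 : ¬ K.skeleton.Adj (⟨w, c⟩ : K.CoverVertex v₀).1 w := K.skeleton.loopless.irrefl w
    unfold place
    rw [dif_pos hqw, dif_neg h1]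
    congr 1
    refine Sigma.ext rfl (heq_of_eq ?_)
    exact (PathClass.comp_assoc c _ _).trans
      ((congrArg c.comp (PathClass.mk_eq (.backtrack h .nil))).trans (PathClass.comp_nil c))
  · have h1 : K.skeleton.Adj (⟨p, c⟩ : K.CoverVertex v₀).1 w := hX.adj p hx w hw hwp.symm
    unfold place
    rw [dif_pos hqw, dif_pos h1]
    congr 1
    refine Sigma.ext rfl (heq_of_eq ?_)
    exact (PathClass.comp_assoc c _ _).trans
      (congrArg c.comp (PathClass.mk_eq (hX.homotopic p hx q hq w hw h hqw h1)))

/-- Two lifts of a coherent set of vertices differ by a proper motion. -/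
theorem IsLift.exists_motion {X Y Z : Finset V} (hX : K.Coherent X) (hY : Y ⊆ X) (hZ : Z ⊆ X)
    {P Q : V → E4} (hP : D.IsLift Y P) (hQ : D.IsLift Z Q) : ∃ φ : E4 ≃ᵃⁱ[ℝ] E4,
      0 < LinearMap.det (φ.linearIsometryEquiv.toLinearEquiv : E4 →ₗ[ℝ] E4) ∧
      ∀ w ∈ X, Q w = φ (P w) := by
  obtain ⟨x, hx, rfl⟩ := hP
  obtain ⟨y, hy, rfl⟩ := hQ
  -- First move the base of one lift over the base of the other; then a deck transformation,
  -- realized by `hol`, relates them.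
  obtain ⟨z, hz, hzx⟩ : ∃ z : K.CoverVertex v₀, z.1 = y.1 ∧
      ∀ w ∈ X, D.place z w = D.place x w := by
    by_cases h : x.1 = y.1
    · exact ⟨x, h, fun _ _ => rfl⟩
    · exact ⟨x.step (hX.adj _ (hY hx) _ (hZ hy) h), rfl,
        fun w hw => D.place_step hX (hY hx) _ (hZ hy) hw⟩
  obtain ⟨g, rfl⟩ := CoverVertex.exists_act hz
  exact ⟨D.hol g, D.hol_proper g, fun w hw => by rw [D.place_act, hzx w hw]⟩

theorem exists_isLift (hK : K.skeleton.Connected) {X : Finset V} (hX : X.Nonempty) :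
    ∃ P, D.IsLift X P := by
  obtain ⟨w, hw⟩ := hX
  obtain ⟨x, rfl⟩ := CoverVertex.exists_over (v₀ := v₀) hK w
  exact ⟨_, x, hw, rfl⟩

variable {D}

theorem IsLift.mono {X Y : Finset V} {P : V → E4} (h : D.IsLift X P) (hXY : X ⊆ Y) :
    D.IsLift Y P := by
  obtain ⟨x, hx, rfl⟩ := h
  exact ⟨x, hXY hx, rfl⟩

/-- The lift chosen by `epsilon` differs from `P` by a motion, so the lengths agree. -/
theorem realizes_sqLength (hK : K.skeleton.Connected) {X : Finset V} (hX : K.Coherent X)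
    {P : V → E4} (hP : D.IsLift X P) : Realizes D.sqLength X P := by
  intro x hx y hy hxy
  obtain ⟨P', hP'⟩ := D.exists_isLift hK (X := {x, y}) (by simp)
  obtain ⟨Q, a, b, hQ, hab, hr⟩ := Classical.epsilon_spec
    (p := fun r : ℝ => ∃ (P : V → E4) (a b : V), D.IsLift {x, y} P ∧
      ({x, y} : Finset V) = {a, b} ∧ r = dist (P a) (P b) ^ 2) ⟨_, P', x, y, hP', rfl, rfl⟩
  have hsub : ({x, y} : Finset V) ⊆ X := by simp [Finset.insert_subset_iff, hx, hy]
  obtain ⟨φ, -, hφ⟩ := IsLift.exists_motion D hX Finset.Subset.rfl hsub hP hQ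
  have ha : a ∈ X := hsub (by simp [hab])
  have hb : b ∈ X := hsub (by simp [hab])
  rw [sqLength, hr, hφ a ha, hφ b hb, φ.dist_map]
  have h1 : x ∈ ({a, b} : Finset V) := by simp [← hab]
  have h2 : y ∈ ({a, b} : Finset V) := by simp [← hab]
  simp only [Finset.mem_insert, Finset.mem_singleton] at h1 h2
  rcases h1 with rfl | rfl <;> rcases h2 with rfl | rfl
  · exact absurd rfl hxy
  · rfl
  · rw [dist_comm]
  · exact absurd rfl hxy

theorem area_eq (hK : K.skeleton.Connected) {X : Finset V} (hX : K.Coherent X)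
    {a b c : V} (ha : a ∈ X) (hb : b ∈ X) (hc : c ∈ X)
    (hab : a ≠ b) (hac : a ≠ c) (hbc : b ≠ c) (h0 : gram D.sqLength a b b ≠ 0) :
    D.area {a, b, c} = √(gram D.sqLength a b b * schur (gram D.sqLength a) b c c) / 2 := by
  obtain ⟨P', hP'⟩ := D.exists_isLift hK (X := {a, b, c}) (by simp)
  obtain ⟨Q, a', b', c', hQ, habc, hr⟩ := Classical.epsilon_spec
    (p := fun r : ℝ => ∃ (P : V → E4) (a' b' c' : V), D.IsLift {a, b, c} P ∧
      ({a, b, c} : Finset V) = {a', b', c'} ∧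
      r = √(‖P b' - P a'‖ ^ 2 * ‖P c' - P a'‖ ^ 2 -
        inner ℝ (P b' - P a') (P c' - P a') ^ 2) / 2) ⟨_, P', a, b, c, hP', rfl, rfl⟩
  rw [area, hr]
  have hsub : ({a, b, c} : Finset V) ⊆ X := by simp [Finset.insert_subset_iff, ha, hb, hc]
  have hreal := realizes_sqLength hK (hX.mono hsub) hQ
  have ha' : a' ∈ ({a, b, c} : Finset V) := by simp [habc]
  have hb' : b' ∈ ({a, b, c} : Finset V) := by simp [habc]
  have hc' : c' ∈ ({a, b, c} : Finset V) := by simp [habc]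
  rw [← real_inner_self_eq_norm_sq, ← real_inner_self_eq_norm_sq, hreal.inner_eq ha' hb' hb',
    hreal.inner_eq ha' hc' hc', hreal.inner_eq ha' hb' hc']
  have hcard : ({a', b', c'} : Finset V).card = 3 := by
    rw [← habc]
    exact Finset.card_eq_three.2 ⟨a, b, c, hab, hac, hbc, rfl⟩
  have h1 : a' ≠ b' := by
    rintro rfl
    rw [Finset.insert_eq_of_mem (by simp)] at hcard
    exact absurd (hcard.symm.le.trans Finset.card_le_two) (by norm_num)
  have h2 : a' ≠ c' := by
    rintro rfl
    rw [Finset.insert_eq_of_mem (by simp)] at hcard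
    exact absurd (hcard.symm.le.trans Finset.card_le_two) (by norm_num)
  have h3 : b' ≠ c' := by
    rintro rfl
    rw [Finset.pair_eq_singleton] at hcard
    exact absurd (hcard.symm.le.trans Finset.card_le_two) (by norm_num)
  congr 2
  have h4 : gram D.sqLength a b b * schur (gram D.sqLength a) b c c =
      gram D.sqLength a b b * gram D.sqLength a c c - gram D.sqLength a b c ^ 2 := by
    rw [schur, gram_comm _ a c b]
    field_simp
  rw [h4]
  -- The Gram determinant is symmetric in the three squared lengths (Heron's formula), so every
  -- ordering that `epsilon` may have chosen gives the same value.
  simp only [Finset.mem_insert, Finset.mem_singleton] at ha' hb' hc'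
  simp only [gram, sqDist_self]
  have e1 := sqDist_comm D.sqLength b a
  have e2 := sqDist_comm D.sqLength c a
  have e3 := sqDist_comm D.sqLength c b
  rcases ha' with rfl | rfl | rfl <;> rcases hb' with rfl | rfl | rfl <;>
    first
    | exact absurd rfl h1
    | (rcases hc' with rfl | rfl | rfl <;>
        first
        | exact absurd rfl h2
        | exact absurd rfl h3
        | (rw [e1, e2, e3]; ring1)
        | (rw [e1, e2]; ring1)
        | (rw [e2, e3]; ring1)
        | (rw [e1]; ring1)
        | (rw [e3]; ring1)
        | ring1)

/-- Proper motions preserve the determinant, and a reordering multiplies both orientation sign and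
determinant by the sign of the permutation. Coherence refers to `K` and orientation to `C`, so new
4-simplices are covered too. -/
theorem volume_eq (hK : K.skeleton.Connected) {X : Finset V} (hX : K.Coherent X)
    {P : V → E4} (hP : D.IsLift X P) {C : AbstractSimplicialComplex V} (o : C.SimplexOrientation)
    {v : Fin 5 → V} (hv : Function.Injective v) (hvX : Finset.univ.image v ⊆ X)
    (hvC : Finset.univ.image v ∈ C.faces) :
    D.volume o (Finset.univ.image v) = ((o.sign v : ℤ) : ℝ) * simplexDet (P ∘ v) / 24 := by
  obtain ⟨P', hP'⟩ := D.exists_isLift hK (X := Finset.univ.image v) (by simp)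
  obtain ⟨Q, v', hQ, hv', himg, hr⟩ := Classical.epsilon_spec
    (p := fun r : ℝ => ∃ (P : V → E4) (u : Fin 5 → V), D.IsLift (Finset.univ.image v) P ∧
      Function.Injective u ∧ Finset.univ.image u = Finset.univ.image v ∧
      r = ((o.sign u : ℤ) : ℝ) *
      (Matrix.of fun i j : Fin 4 => (P (u i.succ) - P (u 0)) j).det / 24)
    ⟨_, P', v, hP', hv, rfl, rfl⟩
  rw [volume, hr]
  obtain ⟨φ, hφ0, hφ⟩ := IsLift.exists_motion D hX Finset.Subset.rfl hvX hP hQ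
  have hQ2 : Q ∘ v' = φ ∘ (P ∘ v') := funext fun i => hφ _ (hvX (by
    rw [← himg]; exact Finset.mem_image_of_mem _ (Finset.mem_univ i)))
  obtain ⟨σ, rfl⟩ : ∃ σ : Equiv.Perm (Fin 5), v' = v ∘ σ :=
    exists_perm_of_image_eq hv' himg
  rw [o.perm v hv hvC]
  have h1 : simplexDet (Q ∘ v ∘ σ) = ((Equiv.Perm.sign σ : ℤ) : ℝ) * simplexDet (P ∘ v) := by
    rw [hQ2, simplexDet_isometry φ hφ0, ← Function.comp_assoc, simplexDet_perm]
  have h2 : (Matrix.of fun i j : Fin 4 => (Q ((v ∘ σ) i.succ) - Q ((v ∘ σ) 0)) j).det =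
    simplexDet (Q ∘ v ∘ σ) := rfl
  rw [h2, h1]
  have h3 : (((Equiv.Perm.sign σ : ℤˣ) : ℤ) : ℝ) * ((Equiv.Perm.sign σ : ℤˣ) : ℤ) = 1 := by
    rw [← Int.cast_mul, Int.units_coe_mul_self, Int.cast_one]
  push_cast
  linear_combination (((o.sign v : ℤ) : ℝ) * simplexDet (P ∘ v) / 24) * h3

end Placement

end AbstractSimplicialComplex

namespace AbstractSimplicialComplex

variable {V : Type*}

/-! ### Differentiability of the deficit angles -/

theorem exists_enumeration {t s : Finset V} {n : ℕ} (ht : t.card = 3) (hts : t ⊆ s)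
    (hs : s.card = n + 3) : ∃ a b c, a ≠ b ∧ a ≠ c ∧ b ≠ c ∧ t = {a, b, c} ∧ (s \ t).card = n := by
  obtain ⟨a, b, c, hab, hac, hbc, rfl⟩ := Finset.card_eq_three.1 ht
  exact ⟨a, b, c, hab, hac, hbc, rfl, by rw [Finset.card_sdiff_of_subset hts, hs, ht]; rfl⟩

theorem exists_enumeration_five {t s : Finset V} (ht : t.card = 3) (hts : t ⊆ s)
    (hs : s.card = 5) : ∃ a b c d e, Function.Injective ![a, b, c, d, e] ∧ t = {a, b, c} ∧
      s = {a, b, c, d, e} := by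
  obtain ⟨a, b, c, hab, hac, hbc, rfl, h2⟩ := exists_enumeration (n := 2) ht hts hs
  obtain ⟨d, e, hde, h3⟩ := Finset.card_eq_two.1 h2
  have hd : d ∈ s \ {a, b, c} := by simp [h3]
  have he : e ∈ s \ {a, b, c} := by simp [h3]
  have hs' : s = {a, b, c, d, e} := by
    rw [← Finset.union_sdiff_of_subset hts, h3]
    ext x; simp; tauto
  simp only [Finset.mem_sdiff, Finset.mem_insert, Finset.mem_singleton, not_or] at hd he
  refine ⟨a, b, c, d, e, ?_, rfl, hs'⟩
  rw [← List.nodup_ofFn]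
  simp [hab, hac, hbc, hde, Ne.symm hd.2.1, Ne.symm hd.2.2.1, Ne.symm hd.2.2.2, Ne.symm he.2.1,
    Ne.symm he.2.2.1, Ne.symm he.2.2.2]

theorem exists_enumeration_six {t s : Finset V} (ht : t.card = 3) (hts : t ⊆ s)
    (hs : s.card = 6) : ∃ a b c d e f, Function.Injective ![a, b, c, d, e, f] ∧ t = {a, b, c} ∧
      s = {a, b, c, d, e, f} ∧ s \ t = {d, e, f} := by
  obtain ⟨a, b, c, hab, hac, hbc, rfl, h2⟩ := exists_enumeration (n := 3) ht hts hs
  obtain ⟨d, e, f, hde, hdf, hef, h3⟩ := Finset.card_eq_three.1 h2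
  have hd : d ∈ s \ {a, b, c} := by simp [h3]
  have he : e ∈ s \ {a, b, c} := by simp [h3]
  have hf : f ∈ s \ {a, b, c} := by simp [h3]
  have hs' : s = {a, b, c, d, e, f} := by
    rw [← Finset.union_sdiff_of_subset hts, h3]
    ext x; simp; tauto
  simp only [Finset.mem_sdiff, Finset.mem_insert, Finset.mem_singleton, not_or] at hd he hf
  refine ⟨a, b, c, d, e, f, ?_, rfl, hs', h3⟩
  rw [← List.nodup_ofFn]
  simp [hab, hac, hbc, hde, hdf, hef, Ne.symm hd.2.1, Ne.symm hd.2.2.1, Ne.symm hd.2.2.2,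
    Ne.symm he.2.1, Ne.symm he.2.2.1, Ne.symm he.2.2.2, Ne.symm hf.2.1, Ne.symm hf.2.2.1,
    Ne.symm hf.2.2.2]

theorem image_five (a b c d e : V) :
    Finset.univ.image ![a, b, c, d, e] = ({a, b, c, d, e} : Finset V) := by
  ext x
  simp [Fin.exists_fin_succ, eq_comm]

theorem simplexDet_ne_zero_of_simplex {s : Finset V} {P : V → E4}
    (h : AffineIndependent ℝ fun w : s => P w) {v : Fin 5 → V} (hv : Function.Injective v)
    (hvs : Finset.univ.image v ⊆ s) : simplexDet (P ∘ v) ≠ 0 := by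
  let g : Fin 5 ↪ s := ⟨fun i => ⟨v i, hvs (Finset.mem_image_of_mem v (Finset.mem_univ i))⟩,
    fun i j hij => hv (congrArg Subtype.val hij)⟩
  exact simplexDet_ne_zero_of_affineIndependent (h.comp_embedding g)

/-- Since `dihedralAngle` is meaningful only at realizable lengths, differentiating it requires
realizability in a whole neighbourhood. -/
theorem dihedralAngle_eventuallyEq {L : Finset V → ℝ} {P : V → E4} {a b c d e : V}
    (hinj : Function.Injective ![a, b, c, d, e])
    (hP : Realizes L {a, b, c, d, e} P) (h : simplexDet (P ∘ ![a, b, c, d, e]) ≠ 0) :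
    (fun L => dihedralAngle L {a, b, c} {a, b, c, d, e}) =ᶠ[nhds L]
      fun L => angleFormula L a b c d e := by
  rw [← image_five] at hP
  filter_upwards [eventually_exists_realizes hinj hP h] with L' ⟨P', hP'⟩
  rw [image_five] at hP'
  exact dihedralAngle_eq hinj hP'

namespace Placement

variable {K C : AbstractSimplicialComplex V} {v₀ : V} {D : K.Placement v₀}

/-- The derivatives of the sum of the three signed dihedral angles at a 2-face `t` of a 5-simplex
`X`, where the weights `w` form an affine dependency of the vertices of the image of `X` in
four-space. -/
theorem hasDerivAt_signed_dihedralAngle_sum (hK : K.skeleton.Connected) {X : Finset V}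
    (hX : K.Coherent X) (hcard : X.card = 6) {P : V → E4} (hP : D.IsLift X P) {w : V → ℝ}
    (hw : ∑ x ∈ X, w x = 0) (hwP : ∑ x ∈ X, w x • P x = 0) (hw0 : ∀ x ∈ X, w x ≠ 0)
    (hdet : ∀ v : Fin 5 → V, Function.Injective v → ∀ z ∈ X, Finset.univ.image v = X.erase z →
      simplexDet (P ∘ v) ^ 2 = w z ^ 2) {t : Finset V} (ht : t.card = 3) (htX : t ⊆ X)
    (e : Finset V) :
    HasDerivAt (fun l => ∑ z ∈ X \ t,
        Real.sign (w z) * dihedralAngle (Function.update D.sqLength e l) t (X.erase z))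
      (D.area t * (∑ x ∈ X, ∑ y ∈ X, w x * w y * sqDist (Pi.single e 1) x y) /
        (2 * ∏ z ∈ X \ t, w z)) (D.sqLength e) := by
  obtain ⟨a, b, c, x, y, z, hinj, rfl, rfl, hXt⟩ := exists_enumeration_six ht htX hcard
  have hreal := realizes_sqLength hK hX hP
  have hne (i j : Fin 6) (hij : i ≠ j) :
    ![a, b, c, x, y, z] i ≠ ![a, b, c, x, y, z] j := hinj.ne hij
  have hab : a ≠ b := hne 0 1 (by decide)
  have hac : a ≠ c := hne 0 2 (by decide)
  have hax : a ≠ x := hne 0 3 (by decide)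
  have hay : a ≠ y := hne 0 4 (by decide)
  have haz : a ≠ z := hne 0 5 (by decide)
  have hbc : b ≠ c := hne 1 2 (by decide)
  have hbx : b ≠ x := hne 1 3 (by decide)
  have hby : b ≠ y := hne 1 4 (by decide)
  have hbz : b ≠ z := hne 1 5 (by decide)
  have hcx : c ≠ x := hne 2 3 (by decide)
  have hcy : c ≠ y := hne 2 4 (by decide)
  have hcz : c ≠ z := hne 2 5 (by decide)
  have hxy : x ≠ y := hne 3 4 (by decide)
  have hxz : x ≠ z := hne 3 5 (by decide)
  have hyz : y ≠ z := hne 4 5 (by decide)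
  have ez : ({a, b, c, x, y, z} : Finset V).erase z = {a, b, c, x, y} := by
    ext u; simp only [Finset.mem_erase, Finset.mem_insert, Finset.mem_singleton]; grind
  have ey : ({a, b, c, x, y, z} : Finset V).erase y = {a, b, c, x, z} := by
    ext u; simp only [Finset.mem_erase, Finset.mem_insert, Finset.mem_singleton]; grind
  have ex : ({a, b, c, x, y, z} : Finset V).erase x = {a, b, c, y, z} := by
    ext u; simp only [Finset.mem_erase, Finset.mem_insert, Finset.mem_singleton]; grind
  have sz : {a, b, c, x, y} ⊆ ({a, b, c, x, y, z} : Finset V) := ez ▸ Finset.erase_subset _ _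
  have sy : {a, b, c, x, z} ⊆ ({a, b, c, x, y, z} : Finset V) := ey ▸ Finset.erase_subset _ _
  have sx : {a, b, c, y, z} ⊆ ({a, b, c, x, y, z} : Finset V) := ex ▸ Finset.erase_subset _ _
  have iz : Function.Injective ![a, b, c, x, y] := by
    rw [← List.nodup_ofFn]; simp [*]
  have iy : Function.Injective ![a, b, c, x, z] := by
    rw [← List.nodup_ofFn]; simp [*]
  have ix : Function.Injective ![a, b, c, y, z] := by
    rw [← List.nodup_ofFn]; simp [*]
  have dz := hdet _ iz z (by simp) (by rw [image_five, ez])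
  have dy := hdet _ iy y (by simp) (by rw [image_five, ey])
  have dx := hdet _ ix x (by simp) (by rw [image_five, ex])
  have wz := hw0 z (by simp)
  have wy := hw0 y (by simp)
  have wx := hw0 x (by simp)
  have hnz {v : Fin 5 → V} {u : V} (hu : w u ≠ 0) (h : simplexDet (P ∘ v) ^ 2 = w u ^ 2) :
      simplexDet (P ∘ v) ≠ 0 := fun h0 => by
    rw [h0] at h
    exact hu ((pow_eq_zero_iff two_ne_zero).1 (h.symm.trans (zero_pow two_ne_zero)))
  have nz : simplexDet (P ∘ ![a, b, c, x, y]) ≠ 0 := hnz wz dz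
  have ny : simplexDet (P ∘ ![a, b, c, x, z]) ≠ 0 := hnz wy dy
  have nx : simplexDet (P ∘ ![a, b, c, y, z]) ≠ 0 := hnz wx dx
  have hg : gram D.sqLength a b b ≠ 0 := by
    rw [← hreal.inner_eq (by simp) (by simp) (by simp)]
    exact (schur_simplexDet P nz).1.ne'
  have main := hasDerivAt_signed_angle_sum hinj hreal hw hwP wx wy wz dz dx dy e
  have htend : Filter.Tendsto (fun l => Function.update D.sqLength e l) (nhds (D.sqLength e))
      (nhds D.sqLength) := by
    have h := (continuous_const (y := D.sqLength).update e continuous_id).tendsto (D.sqLength e)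
    simpa using h
  have hz := htend.eventually (dihedralAngle_eventuallyEq iz 
    (hreal.mono sz) nz)
  have hy := htend.eventually (dihedralAngle_eventuallyEq iy 
    (hreal.mono sy) ny)
  have hx := htend.eventually (dihedralAngle_eventuallyEq ix 
    (hreal.mono sx) nx)
  have hsx : x ∉ ({y, z} : Finset V) := by simp [*]
  have hsy : y ∉ ({z} : Finset V) := by simp [*]
  refine (main.congr_of_eventuallyEq ?_).congr_deriv ?_
  · filter_upwards [hx, hy, hz] with l h1 h2 h3
    rw [hXt, Finset.sum_insert hsx, Finset.sum_insert hsy, Finset.sum_singleton, ex, ey, ez, h1,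
      h2, h3, add_assoc]
  -- The square root is twice the area, whence 2 in place of 4 in the denominator.
  · rw [area_eq hK hX (by simp) (by simp) (by simp) hab hac hbc hg, hXt, Finset.prod_insert hsx,
      Finset.prod_insert hsy, Finset.prod_singleton]
    field_simp
    ring

end Placement

variable [Fintype V]

theorem mem_simplices {K : AbstractSimplicialComplex V} {n : ℕ} {s : Finset V} :
    s ∈ K.simplices n ↔ s ∈ K.faces ∧ s.card = n + 1 := by
  simp [simplices]

theorem coherent_of_mem_simplices {K : AbstractSimplicialComplex V} {n : ℕ} {s : Finset V}
    (hs : s ∈ K.simplices n) : K.Coherent s :=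
  coherent_of_mem_faces (mem_simplices.1 hs).1

theorem differentiableAt_schur {ι : Type*} {g : (Finset V → ℝ) → ι → ι → ℝ} {L : Finset V → ℝ}
    (hg : ∀ x y, DifferentiableAt ℝ (fun L => g L x y) L) {b : ι} (hb : g L b b ≠ 0) (x y : ι) :
    DifferentiableAt ℝ (fun L => schur (g L) b x y) L := by
  simp only [schur, div_eq_mul_inv]
  exact (hg x y).fun_sub (((hg x b).fun_mul (hg y b)).fun_mul ((hg b b).fun_inv hb))

theorem differentiable_gram (a x y : V) :
    Differentiable ℝ fun L : Finset V → ℝ => gram L a x y := by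
  have h (x y : V) : Differentiable ℝ fun L : Finset V → ℝ => sqDist L x y := by
    unfold sqDist
    split_ifs
    · exact differentiable_const _
    · exact differentiable_apply _
  simp only [gram, div_eq_mul_inv]
  exact (((h a x).fun_add (h a y)).fun_sub (h x y)).mul_const _

/-- Nondegeneracy makes the 2×2 minor of the normals positive, which keeps the cosine away from ±1,
where `arccos` is not differentiable. -/
theorem differentiableAt_angleFormula {L : Finset V → ℝ} {P : V → E4} {a b c d e : V}
    (hP : Realizes L {a, b, c, d, e} P) (h : simplexDet (P ∘ ![a, b, c, d, e]) ≠ 0) :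
    DifferentiableAt ℝ (fun L => angleFormula L a b c d e) L := by
  have h1 := schur_simplexDet P h
  simp only [hP.inner_eq (a := a) (x := b) (y := b) (by simp) (by simp) (by simp),
    hP.schur_eq (a := a) (b := b) (x := c) (y := c) (by simp) (by simp) (by simp) (by simp),
    hP.normalGram_eq (a := a) (b := b) (c := c) (x := d) (y := d)
      (by simp) (by simp) (by simp) (by simp) (by simp),
    hP.normalGram_eq (a := a) (b := b) (c := c) (x := e) (y := e)
      (by simp) (by simp) (by simp) (by simp) (by simp),
    hP.normalGram_eq (a := a) (b := b) (c := c) (x := d) (y := e)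
      (by simp) (by simp) (by simp) (by simp) (by simp)] at h1
  obtain ⟨hb, hc, hd, he, hdet⟩ := h1
  have hN := differentiableAt_schur (differentiableAt_schur
    (fun x y => (differentiable_gram a x y).differentiableAt) hb.ne') (b := c) hc.ne'
  have hD : 0 < normalGram L a b c d d * normalGram L a b c e e - normalGram L a b c d e ^ 2 := by
    refine pos_of_mul_pos_right (a := gram L a b b * schur (gram L a) b c c) ?_ (by positivity)
    rw [hdet]
    positivity
  have hlt : (normalGram L a b c d e /
      (√(normalGram L a b c d d) * √(normalGram L a b c e e))) ^ 2 < 1 := by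
    rw [div_pow, mul_pow, Real.sq_sqrt hd.le, Real.sq_sqrt he.le, div_lt_one (mul_pos hd he)]
    linarith
  simp only [angleFormula, div_eq_mul_inv] at hlt ⊢
  refine DifferentiableAt.comp (g := Real.arccos) L
    (Real.differentiableAt_arccos.2 ⟨fun h => ?_, fun h => ?_⟩)
    ((hN d e).fun_mul
      ((((hN d d).sqrt hd.ne').fun_mul ((hN e e).sqrt he.ne')).fun_inv ?_))
  · change normalGram L a b c d e *
      (√(normalGram L a b c d d) * √(normalGram L a b c e e))⁻¹ = -1 at h
    rw [h] at hlt
    norm_num at hlt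
  · change normalGram L a b c d e *
      (√(normalGram L a b c d d) * √(normalGram L a b c e e))⁻¹ = 1 at h
    rw [h] at hlt
    norm_num at hlt
  · exact (mul_pos (Real.sqrt_pos.2 hd) (Real.sqrt_pos.2 he)).ne'

namespace Placement

variable {K C : AbstractSimplicialComplex V} {v₀ : V} {D : K.Placement v₀}

theorem IsNondegenerate.differentiableAt_deficit (hD : D.IsNondegenerate C)
    (hK : K.skeleton.Connected) (hC : ∀ s ∈ C.simplices 4, K.Coherent s) (o : C.SimplexOrientation)
    {t : Finset V} (ht : t.card = 3) : DifferentiableAt ℝ (D.deficit o t) D.sqLength := by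
  have h : DifferentiableAt ℝ (fun L => ∑ s ∈ (C.simplices 4).filter (fun s => t ⊆ s),
      Real.sign (D.volume o s) * dihedralAngle L t s) D.sqLength := by
    refine DifferentiableAt.fun_sum fun s hs => DifferentiableAt.const_mul ?_ _
    obtain ⟨hs4, hts⟩ := Finset.mem_filter.1 hs
    obtain ⟨a, b, c, d, e, hinj, rfl, rfl⟩ := exists_enumeration_five ht hts
      (mem_simplices.1 hs4).2
    obtain ⟨P, hP⟩ := D.exists_isLift hK (X := {a, b, c, d, e}) (by simp)
    have hdet := simplexDet_ne_zero_of_simplex (hD _ hs4 P hP) hinj (image_five _ _ _ _ _).subset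
    have hreal := realizes_sqLength hK (hC _ hs4) hP
    exact (differentiableAt_angleFormula hreal hdet).congr_of_eventuallyEq
      (dihedralAngle_eventuallyEq hinj hreal hdet)
  exact h.neg

end Placement

end AbstractSimplicialComplex

namespace AbstractSimplicialComplex

variable {V : Type*} [Fintype V] {K : AbstractSimplicialComplex V}

open Placement

/-! ### The combinatorics of the move -/

/-- A tetrahedron has exactly two cofaces; `r` is the apex on the far side of the one opposite `y`.
-/
theorem IsClosedFourManifold.exists_opposite (hK : K.IsClosedFourManifold) {s : Finset V}
    (hs : s ∈ K.simplices 4) {y : V} (hy : y ∈ s) :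
    ∃ r ∉ s, insert r (s.erase y) ∈ K.simplices 4 := by
  obtain ⟨hsK, hcard⟩ := mem_simplices.1 hs
  have hcard' : (s.erase y).card = 4 := by rw [Finset.card_erase_of_mem hy, hcard]
  have h3 : s.erase y ∈ K.simplices 3 := mem_simplices.2
    ⟨face_subset hsK (Finset.erase_subset _ _) (Finset.card_pos.1 (by omega)), hcard'⟩
  have h2 := hK.closed _ h3
  have hsF : s ∈ (K.simplices 4).filter fun r => s.erase y ⊆ r :=
    Finset.mem_filter.2 ⟨hs, Finset.erase_subset _ _⟩
  obtain ⟨s', hs'F, hne⟩ := Finset.exists_mem_ne (by rw [h2]; norm_num) s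
  obtain ⟨hs', hsub⟩ := Finset.mem_filter.1 hs'F
  have hc' := (mem_simplices.1 hs').2
  obtain ⟨r, hr, hins⟩ := (Finset.covBy_iff_exists_insert (s := s.erase y) (t := s')).1
    (Finset.covBy_iff_card_sdiff_eq_one.2 ⟨hsub, by rw [Finset.card_sdiff_of_subset hsub]; omega⟩)
  refine ⟨r, fun hrs => ?_, by rwa [hins]⟩
  rcases eq_or_ne r y with rfl | hry
  · rw [Finset.insert_erase hy] at hins
    exact hne hins.symm
  · exact hr (Finset.mem_erase.2 ⟨hry, hrs⟩)

/-- The link of a 2-face that belongs to three 4-simplices is a triangle. -/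
theorem IsClosedFourManifold.exists_isThreeStar (hK : K.IsClosedFourManifold) {t : Finset V}
    (ht : t ∈ K.simplices 2) (h3 : ((K.simplices 4).filter fun s => t ⊆ s).card = 3) :
    ∃ u, K.IsThreeStar t u := by
  obtain ⟨htK, htc⟩ := mem_simplices.1 ht
  set F := (K.simplices 4).filter fun s => t ⊆ s with hF
  obtain ⟨s, hs⟩ := Finset.card_pos.1 (by omega : 0 < F.card)
  obtain ⟨hs4, hts⟩ := Finset.mem_filter.1 hs
  have hsc := (mem_simplices.1 hs4).2
  obtain ⟨p, q, hpq, hst⟩ := Finset.card_eq_two.1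
    (by rw [Finset.card_sdiff_of_subset hts, hsc, htc] : (s \ t).card = 2)
  have hp : p ∈ s \ t := by simp [hst]
  have hq : q ∈ s \ t := by simp [hst]
  obtain ⟨hps, hpt⟩ := Finset.mem_sdiff.1 hp
  obtain ⟨hqs, hqt⟩ := Finset.mem_sdiff.1 hq
  have hs_eq : s = insert p (insert q t) := by
    rw [← Finset.sdiff_union_of_subset hts, hst]; ext; simp
  -- Crossing the two tetrahedra of `s` that contain `t` gives two further 4-simplices, and by the
  -- count there are no others.
  obtain ⟨r, hrs, hr⟩ := hK.exists_opposite hs4 hqs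
  obtain ⟨r', hrs', hr'⟩ := hK.exists_opposite hs4 hps
  have e1 : insert r (s.erase q) = insert r (insert p t) := by
    rw [hs_eq]; ext x; simp only [Finset.mem_insert, Finset.mem_erase]; grind
  have e2 : insert r' (s.erase p) = insert r' (insert q t) := by
    rw [hs_eq]; ext x; simp only [Finset.mem_insert, Finset.mem_erase]; grind
  rw [e1] at hr
  rw [e2] at hr'
  have hrt : r ∉ t := fun h => hrs (hts h)
  have hrp : r ≠ p := fun h => hrs (h ▸ hps)
  have hrq : r ≠ q := fun h => hrs (h ▸ hqs)
  have hrq' : r' ≠ q := fun h => hrs' (h ▸ hqs)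
  have hrp' : r' ≠ p := fun h => hrs' (h ▸ hps)
  have hF3 : F = {s, insert r (insert p t), insert r' (insert q t)} := by
    refine (Finset.eq_of_subset_of_card_le ?_ ?_).symm
    · simp only [Finset.insert_subset_iff, Finset.singleton_subset_iff, hF, Finset.mem_filter]
      exact ⟨⟨hs4, hts⟩, ⟨hr, fun x hx => by simp [hx]⟩, ⟨hr', fun x hx => by simp [hx]⟩⟩
    · rw [h3, Finset.card_eq_three.2 ⟨_, _, _, ?_, ?_, ?_, rfl⟩]
      · exact fun h => hrs (by rw [h]; simp)
      · exact fun h => hrs' (by rw [h]; simp)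
      · intro h
        have : p ∈ insert r' (insert q t) := by rw [← h]; simp
        simp [hpq, hpt, hrp'.symm] at this
  -- Going on around `t` from the second 4-simplex must lead to the third, which closes the link and
  -- forces `r = r'`.
  obtain ⟨r₂, hr₂, hr₂'⟩ := hK.exists_opposite hr (y := p) (by simp)
  have hmem : insert r₂ ((insert r (insert p t)).erase p) ∈ F :=
    Finset.mem_filter.2 ⟨hr₂', fun x hx => by
      have : x ≠ p := fun h => hpt (h ▸ hx)
      simp [hx, this]⟩
  have hrr : r = r' := by
    rw [hF3] at hmem
    simp only [Finset.mem_insert, Finset.mem_singleton] at hmem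
    have hrm : r ∈ insert r₂ ((insert r (insert p t)).erase p) := by simp [hrp]
    rcases hmem with h | h | h
    · rw [h] at hrm; exact absurd hrm hrs
    · exact absurd (by rw [← h]; simp) hr₂
    · rw [h] at hrm
      simpa [hrq, hrt] using hrm
  subst hrr
  refine ⟨{p, q, r}, htc, Finset.card_eq_three.2 ⟨p, q, r, hpq, hrp.symm, hrq.symm, rfl⟩, ?_,
    fun s' => ?_⟩
  · simp [Finset.disjoint_left] 
    grind
  · rw [← Finset.mem_filter, ← hF, hF3, hs_eq]
    have f1 : (t ∪ {p, q, r}).erase r = insert p (insert q t) := by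
      ext x; simp only [Finset.mem_erase, Finset.mem_insert, Finset.mem_union, Finset.mem_singleton]
      grind
    have f2 : (t ∪ {p, q, r}).erase q = insert r (insert p t) := by
      ext x; simp only [Finset.mem_erase, Finset.mem_insert, Finset.mem_union, Finset.mem_singleton]
      grind
    have f3 : (t ∪ {p, q, r}).erase p = insert r (insert q t) := by
      ext x; simp only [Finset.mem_erase, Finset.mem_insert, Finset.mem_union, Finset.mem_singleton]
      grind
    simp only [Finset.mem_insert, Finset.mem_singleton, exists_eq_or_imp, exists_eq_left, f1, f2,
      f3]
    tauto

/-! ### Simplices of the flipped complex. -/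

namespace IsThreeStar

variable {t u : Finset V}

theorem card_union (h : K.IsThreeStar t u) : (t ∪ u).card = 6 := by
  rw [Finset.card_union_of_disjoint h.disjoint, h.card_left, h.card_right]

theorem erase_mem (h : K.IsThreeStar t u) {y : V} (hy : y ∈ u) :
    (t ∪ u).erase y ∈ K.simplices 4 :=
  ((h.star _).2 ⟨y, hy, rfl⟩).1

theorem mem_faces (h : K.IsThreeStar t u) {s : Finset V} (hs : s ⊆ t ∪ u) (hne : s.Nonempty)
    (hus : ¬ u ⊆ s) : s ∈ K.faces := by
  obtain ⟨y, hy, hys⟩ := Finset.not_subset.1 hus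
  exact face_subset (mem_simplices.1 (h.erase_mem hy)).1
    (fun x hx => Finset.mem_erase.2 ⟨fun hxy => hys (hxy ▸ hx), hs hx⟩) hne

theorem adj (h : K.IsThreeStar t u) {p q : V} (hp : p ∈ t ∪ u) (hq : q ∈ t ∪ u) (hpq : p ≠ q) :
    K.skeleton.Adj p q := by
  refine ⟨hpq, h.mem_faces ?_ ⟨p, by simp⟩ fun hu => ?_⟩
  · exact Finset.insert_subset_iff.2 ⟨hp, Finset.singleton_subset_iff.2 hq⟩
  · have := (Finset.card_le_card hu).trans Finset.card_le_two
    rw [h.card_right] at this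
    omega

/-- Every triple other than `u` is a face of an old 4-simplex. The boundary of `u` is contracted
over the cone with apex `z` in `t`, whose three triangles are faces. Hence all six vertices lift
together, and so do the new 4-simplices. -/
theorem coherent (h : K.IsThreeStar t u) : K.Coherent (t ∪ u) := by
  refine ⟨fun p hp q hq hpq => h.adj hp hq hpq, ?_⟩
  intro p hp q hq w hw h₁ h₂ h₃
  have hsub {a b c : V} (ha : a ∈ t ∪ u) (hb : b ∈ t ∪ u) (hc : c ∈ t ∪ u) :
      ({a, b, c} : Finset V) ⊆ t ∪ u :=
    Finset.insert_subset_iff.2 ⟨ha, Finset.insert_subset_iff.2 ⟨hb,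
      Finset.singleton_subset_iff.2 hc⟩⟩
  by_cases hu : u ⊆ {p, q, w}
  · have hu' : u = {p, q, w} := Finset.eq_of_subset_of_card_le hu (by
      rw [h.card_right]; exact Finset.card_le_three)
    obtain ⟨z, hz⟩ := Finset.card_pos.1 (by rw [h.card_left]; norm_num : 0 < t.card)
    have hzu : z ∉ u := Finset.disjoint_left.1 h.disjoint hz
    have hz' : z ∈ t ∪ u := Finset.mem_union_left _ hz
    have hface {a b : V} (ha : a ∈ t ∪ u) (hb : b ∈ t ∪ u) : {z, a, b} ∈ K.faces := by
      refine h.mem_faces (hsub hz' ha hb) ⟨z, by simp⟩ fun hus => hzu ?_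
      rw [Finset.eq_of_subset_of_card_le hus (by rw [h.card_right]; exact Finset.card_le_three)]
      simp
    have hadj {a : V} (ha : a ∈ u) : K.skeleton.Adj z a :=
      h.adj hz' (Finset.mem_union_right _ ha) fun hza => hzu (hza ▸ ha)
    have hpz : K.skeleton.Adj p z := (hadj (by rw [hu']; simp)).symm
    have hzq : K.skeleton.Adj z q := hadj (by rw [hu']; simp)
    have hzw : K.skeleton.Adj z w := hadj (by rw [hu']; simp)
    have t1 : Homotopic K (.cons hpz (.cons hzq (.cons h₂ .nil))) (.cons h₁ (.cons h₂ .nil)) :=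
      .triangle hpz hzq h₁ (by rw [Finset.insert_comm]; exact hface hp hq) _
    have t2 : Homotopic K (.cons hpz (.cons hzq (.cons h₂ .nil))) (.cons hpz (.cons hzw .nil)) :=
      .cons hpz (.triangle hzq h₂ hzw (hface hq hw) _)
    have t3 : Homotopic K (.cons hpz (.cons hzw .nil)) (.cons h₃ .nil) :=
      .triangle hpz hzw h₃ (by rw [Finset.insert_comm]; exact hface hp hw) _
    exact t1.symm.trans (t2.trans t3)
  · exact .triangle h₁ h₂ h₃ (h.mem_faces (hsub hp hq hw) ⟨p, by simp⟩ hu) _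

theorem eq_erase (h : K.IsThreeStar t u) {s : Finset V} (hs : s ⊆ t ∪ u) (hcard : s.card = 5) :
    ∃ y ∈ t ∪ u, y ∉ s ∧ s = (t ∪ u).erase y := by
  have h1 : ((t ∪ u) \ s).card = 1 := by
    rw [Finset.card_sdiff_of_subset hs, h.card_union, hcard]
  obtain ⟨y, hy⟩ := Finset.card_eq_one.1 h1
  have hy' : y ∈ (t ∪ u) \ s := by simp [hy]
  obtain ⟨hyX, hys⟩ := Finset.mem_sdiff.1 hy'
  refine ⟨y, hyX, hys, Finset.eq_of_subset_of_card_le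
    (fun x hx => Finset.mem_erase.2 ⟨fun hxy => hys (hxy ▸ hx), hs hx⟩) ?_⟩
  rw [Finset.card_erase_of_mem hyX, h.card_union, hcard]

theorem mem_flip_simplices_four (h : K.IsThreeStar t u) {s : Finset V} :
    s ∈ (K.flip t u h).simplices 4 ↔
      (s ∈ K.simplices 4 ∧ ¬ t ⊆ s) ∨ ∃ y ∈ t, s = (t ∪ u).erase y := by
  rw [mem_simplices, mem_simplices]
  constructor
  · rintro ⟨⟨hs, hts⟩ | ⟨hus, hsX, hts⟩, hcard⟩
    · exact Or.inl ⟨⟨hs, hcard⟩, hts⟩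
    · obtain ⟨y, hy, hys, rfl⟩ := h.eq_erase hsX hcard
      exact Or.inr ⟨y, (Finset.mem_union.1 hy).resolve_right fun hyu => hys (hus hyu), rfl⟩
  · rintro (⟨⟨hs, hcard⟩, hts⟩ | ⟨y, hy, rfl⟩)
    · exact ⟨Or.inl ⟨hs, hts⟩, hcard⟩
    · refine ⟨Or.inr ⟨fun x hx => Finset.mem_erase.2 ⟨?_, Finset.mem_union_right _ hx⟩,
        Finset.erase_subset _ _, fun hsub => Finset.notMem_erase y _ (hsub hy)⟩, ?_⟩
      · rintro rfl
        exact Finset.disjoint_left.1 h.disjoint hy hx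
      · rw [Finset.card_erase_of_mem (Finset.mem_union_left _ hy), h.card_union]

theorem flip_simplices_two (h : K.IsThreeStar t u) :
    (K.flip t u h).simplices 2 = insert u ((K.simplices 2).erase t) := by
  ext s
  rw [mem_simplices, Finset.mem_insert, Finset.mem_erase, mem_simplices]
  constructor
  · rintro ⟨⟨hs, hts⟩ | ⟨hus, hsX, hts⟩, hcard⟩
    · exact Or.inr ⟨fun hst => hts hst.symm.subset, hs, hcard⟩
    · exact Or.inl (Finset.eq_of_subset_of_card_le hus (by rw [hcard, h.card_right])).symm
  · rintro (rfl | ⟨hne, hs, hcard⟩)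
    · refine ⟨Or.inr ⟨Finset.Subset.rfl, Finset.subset_union_right, fun hts => ?_⟩, h.card_right⟩
      obtain ⟨z, hz⟩ := Finset.card_pos.1 (by rw [h.card_left]; norm_num : 0 < t.card)
      exact Finset.disjoint_left.1 h.disjoint hz (hts hz)
    · exact ⟨Or.inl ⟨hs, fun hts => hne
        (Finset.eq_of_subset_of_card_le hts (by rw [hcard, h.card_left])).symm⟩, hcard⟩

theorem simplices_four_eq (h : K.IsThreeStar t u) : K.simplices 4 =
    (K.simplices 4).filter (fun s => ¬ t ⊆ s) ∪ u.image fun y => (t ∪ u).erase y := by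
  ext s
  have := h.star s
  simp only [Finset.mem_union, Finset.mem_filter, Finset.mem_image, eq_comm (b := s)]
  rw [← this]
  tauto

theorem flip_simplices_four_eq (h : K.IsThreeStar t u) : (K.flip t u h).simplices 4 =
    (K.simplices 4).filter (fun s => ¬ t ⊆ s) ∪ t.image fun y => (t ∪ u).erase y := by
  ext s
  rw [h.mem_flip_simplices_four]
  simp only [Finset.mem_union, Finset.mem_filter, Finset.mem_image, eq_comm (b := s)]

theorem disjoint_old (h : K.IsThreeStar t u) : Disjoint
    ((K.simplices 4).filter fun s => ¬ t ⊆ s) (u.image fun y => (t ∪ u).erase y) := by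
  rw [Finset.disjoint_left]
  intro s hs hs'
  obtain ⟨y, hy, rfl⟩ := Finset.mem_image.1 hs'
  exact (Finset.mem_filter.1 hs).2 ((h.star _).2 ⟨y, hy, rfl⟩).2

/-- Each new 4-simplex contains `u`, which is not a face of the old complex. -/
theorem disjoint_new (h : K.IsThreeStar t u) (hu : u ∉ K.faces) : Disjoint
    ((K.simplices 4).filter fun s => ¬ t ⊆ s) (t.image fun y => (t ∪ u).erase y) := by
  rw [Finset.disjoint_left]
  intro s hs hs'
  obtain ⟨y, hy, rfl⟩ := Finset.mem_image.1 hs'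
  refine hu (face_subset (mem_simplices.1 (Finset.mem_filter.1 hs).1).1 (fun x hx => ?_)
    (Finset.card_pos.1 (by rw [h.card_right]; norm_num)))
  refine Finset.mem_erase.2 ⟨?_, Finset.mem_union_right _ hx⟩
  rintro rfl
  exact Finset.disjoint_left.1 h.disjoint hy hx

theorem coherent_flip (h : K.IsThreeStar t u) :
    ∀ s ∈ (K.flip t u h).simplices 4, K.Coherent s := by
  intro s hs
  rcases h.mem_flip_simplices_four.1 hs with ⟨hs, -⟩ | ⟨y, -, rfl⟩
  · exact coherent_of_mem_simplices hs
  · exact h.coherent.mono (Finset.erase_subset _ _)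

/-- A 4-simplex outside the star, adjacent to an old 4-simplex and to a new one. -/
theorem exists_outer (h : K.IsThreeStar t u) (hK : K.IsClosedFourManifold) (hu : u ∉ K.faces)
    {y z : V} (hy : y ∈ t) (hz : z ∈ u) :
    ∃ r ∉ t ∪ u, insert r (((t ∪ u).erase z).erase y) ∈ K.faces ∧
      insert r (((t ∪ u).erase z).erase y) ∈ (K.flip t u h).faces := by
  have hyz : y ≠ z := fun e => Finset.disjoint_left.1 h.disjoint hy (e ▸ hz)
  obtain ⟨r, hr, hmem⟩ := hK.exists_opposite (h.erase_mem hz) (y := y)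
    (Finset.mem_erase.2 ⟨hyz, Finset.mem_union_left _ hy⟩)
  have hrX : r ∉ t ∪ u := by
    -- The only vertex of the star outside the old 4-simplex is `z`, and the neighbour with apex `z`
    -- would contain `u`.
    intro hrX
    obtain rfl : r = z := by
      by_contra hne
      exact hr (Finset.mem_erase.2 ⟨hne, hrX⟩)
    refine hu (face_subset (mem_simplices.1 hmem).1 (fun x hx => ?_)
      (Finset.card_pos.1 (by rw [h.card_right]; norm_num)))
    have hxy : x ≠ y := fun e => Finset.disjoint_left.1 h.disjoint hy (e ▸ hx)
    by_cases hxr : x = r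
    · simp [hxr]
    · simp [hxr, hxy, hx]
  refine ⟨r, hrX, (mem_simplices.1 hmem).1, Or.inl ⟨(mem_simplices.1 hmem).1, fun hts => ?_⟩⟩
  have := hts hy
  simp only [Finset.mem_insert, Finset.mem_erase, ne_eq, not_true_eq_false, false_and,
    or_false] at this
  exact hrX (this ▸ Finset.mem_union_left _ hy)

end IsThreeStar

end AbstractSimplicialComplex

namespace AbstractSimplicialComplex

variable {V : Type*}

/-! ### Orientations around the move -/

theorem image_comp_succAbove {n : ℕ} {p : Fin (n + 1) → V} (hp : Function.Injective p)
    (k : Fin (n + 1)) :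
    Finset.univ.image (p ∘ k.succAbove) = (Finset.univ.image p).erase (p k) := by
  ext x
  simp only [Finset.mem_image, Finset.mem_univ, true_and, Finset.mem_erase, Function.comp_apply]
  constructor
  · rintro ⟨i, rfl⟩
    exact ⟨fun h => Fin.succAbove_ne k i (hp h), _, rfl⟩
  · rintro ⟨hx, j, rfl⟩
    obtain ⟨i, rfl⟩ := Fin.exists_succAbove_eq (y := k) (x := j) fun h => hx (h ▸ rfl)
    exact ⟨i, rfl⟩

theorem injective_update {n : ℕ} {v : Fin n → V} (hv : Function.Injective v) (i : Fin n) {r : V}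
    (hr : ∀ j, v j ≠ r) : Function.Injective (Function.update v i r) := by
  intro j k hjk
  by_cases hj : j = i <;> by_cases hk : k = i
  · rw [hj, hk]
  · rw [hj, Function.update_self, Function.update_of_ne hk] at hjk
    exact absurd hjk.symm (hr k)
  · rw [hk, Function.update_self, Function.update_of_ne hj] at hjk
    exact absurd hjk (hr j)
  · rw [Function.update_of_ne hj, Function.update_of_ne hk] at hjk
    exact hv hjk

theorem image_update {n : ℕ} {v : Fin n → V} (hv : Function.Injective v) (i : Fin n) (r : V) :
    Finset.univ.image (Function.update v i r) = insert r ((Finset.univ.image v).erase (v i)) := by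
  ext x
  simp only [Finset.mem_image, Finset.mem_univ, true_and, Finset.mem_insert, Finset.mem_erase]
  constructor
  · rintro ⟨j, rfl⟩
    by_cases hj : j = i
    · exact Or.inl (by rw [hj, Function.update_self])
    · rw [Function.update_of_ne hj]
      exact Or.inr ⟨hv.ne hj, j, rfl⟩
  · rintro (rfl | ⟨hx, j, rfl⟩)
    · exact ⟨i, Function.update_self ..⟩
    · exact ⟨j, Function.update_of_ne (fun hj : j = i => hx (by rw [hj])) _ _⟩

/-- Omitting entry `k` or entry `k + 1` gives tuples that differ only in position `k`, so the signs
alternate as in the boundary of a 5-simplex. -/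
theorem SimplexOrientation.sign_succ {C : AbstractSimplicialComplex V} (o : C.SimplexOrientation)
    {p : Fin 6 → V} (hp : Function.Injective p) (k : Fin 5)
    (h₁ : (Finset.univ.image p).erase (p k.castSucc) ∈ C.faces)
    (h₂ : (Finset.univ.image p).erase (p k.succ) ∈ C.faces) :
    o.sign (p ∘ k.succ.succAbove) = -o.sign (p ∘ k.castSucc.succAbove) := by
  rw [← image_comp_succAbove hp] at h₁ h₂
  have hupd : p ∘ k.succ.succAbove =
      Function.update (p ∘ k.castSucc.succAbove) k (p k.castSucc) := by
    ext i
    fin_cases k <;> fin_cases i <;> rfl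
  rw [hupd] at h₂ ⊢
  refine o.adjacent _ _ _ (hp.comp Fin.succAbove_right_injective) h₁ ?_ h₂
  rintro ⟨i, hi⟩
  exact Fin.succAbove_ne _ i (hp hi)

variable [Fintype V] {K : AbstractSimplicialComplex V}

open Placement

/-- The signs of the old and of the new 4-simplices, compared with the boundary of a 5-simplex. -/
theorem IsThreeStar.exists_orientation {t u : Finset V} (h : K.IsThreeStar t u)
    (hK : K.IsClosedFourManifold) (hu : u ∉ K.faces) (o : K.SimplexOrientation)
    (o' : (K.flip t u h).SimplexOrientation)
    (ho : ∀ v : Fin 5 → V, Function.Injective v → Finset.univ.image v ∈ K.faces →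
      Finset.univ.image v ∈ (K.flip t u h).faces → o'.sign v = o.sign v) :
    ∃ (p : Fin 6 → V) (ε : ℤˣ), Function.Injective p ∧ Finset.univ.image p = t ∪ u ∧
      (∀ k, p k ∈ u → o.sign (p ∘ k.succAbove) = (-1) ^ (k : ℕ) * ε) ∧
      (∀ k, p k ∈ t → o'.sign (p ∘ k.succAbove) = -((-1) ^ (k : ℕ) * ε)) := by
  obtain ⟨a, b, c, d, e, f, hp, rfl, hX, hXt⟩ := exists_enumeration_six h.card_left
    Finset.subset_union_left h.card_union
  rw [Finset.union_sdiff_cancel_left h.disjoint] at hXt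
  subst hXt
  set p := ![a, b, c, d, e, f] with hp_def
  have himg : Finset.univ.image p = {a, b, c} ∪ {d, e, f} := by
    rw [hX]; ext x; simp [Fin.exists_fin_succ, hp_def, eq_comm]
  have hold (k : Fin 6) (hk : p k ∈ ({d, e, f} : Finset V)) :
      (Finset.univ.image p).erase (p k) ∈ K.faces := by
    rw [himg]; exact (mem_simplices.1 (h.erase_mem hk)).1
  have hnew (k : Fin 6) (hk : p k ∈ ({a, b, c} : Finset V)) :
      (Finset.univ.image p).erase (p k) ∈ (K.flip _ _ h).faces := by
    rw [himg]; exact (mem_simplices.1 (h.mem_flip_simplices_four.2 (Or.inr ⟨_, hk, rfl⟩))).1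
  have s43 := o.sign_succ hp 3 (hold 3 (by simp [hp_def])) (hold 4 (by simp [hp_def]))
  have s54 := o.sign_succ hp 4 (hold 4 (by simp [hp_def])) (hold 5 (by simp [hp_def]))
  have s10 := o'.sign_succ hp 0 (hnew 0 (by simp [hp_def])) (hnew 1 (by simp [hp_def]))
  have s21 := o'.sign_succ hp 1 (hnew 1 (by simp [hp_def])) (hnew 2 (by simp [hp_def]))
  -- The 4-simplices omitting `c` and `d` lie on the same side of a tetrahedron whose far side
  -- carries a 4-simplex common to both complexes. Both signs are opposite to that of the common
  -- one, hence equal; in an oriented boundary they would be opposite, whence the minus for the new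
  -- signs.
  have s23 : o'.sign (p ∘ (2 : Fin 6).succAbove) = o.sign (p ∘ (3 : Fin 6).succAbove) := by
    obtain ⟨r, hr, hr1, hr2⟩ := h.exists_outer hK hu (y := p 2) (z := p 3) (by simp [hp_def])
      (by simp [hp_def])
    rw [← himg] at hr hr1 hr2
    have hupd : Function.update (p ∘ (2 : Fin 6).succAbove) 2 r =
        Function.update (p ∘ (3 : Fin 6).succAbove) 2 r := by
      ext i
      fin_cases i <;> rfl
    have hrp (k : Fin 6) : p k ≠ r := fun hk => hr (by
      rw [← hk]; exact Finset.mem_image_of_mem p (Finset.mem_univ k))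
    have himg' : Finset.univ.image (Function.update (p ∘ (3 : Fin 6).succAbove) 2 r) =
        insert r (((Finset.univ.image p).erase (p 3)).erase (p 2)) := by
      rw [image_update (hp.comp Fin.succAbove_right_injective), image_comp_succAbove hp]
      rfl
    have hinj' : Function.Injective (Function.update (p ∘ (3 : Fin 6).succAbove) 2 r) :=
      injective_update (hp.comp Fin.succAbove_right_injective) 2 fun _ => hrp _
    have h1 := o.adjacent (p ∘ (3 : Fin 6).succAbove) 2 r (hp.comp Fin.succAbove_right_injective)
      (by rw [image_comp_succAbove hp]; exact hold 3 (by simp [hp_def]))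
      (by rintro ⟨i, hi⟩; exact hrp _ hi) (by rwa [himg'])
    have h2 := o'.adjacent (p ∘ (2 : Fin 6).succAbove) 2 r (hp.comp Fin.succAbove_right_injective)
      (by rw [image_comp_succAbove hp]; exact hnew 2 (by simp [hp_def]))
      (by rintro ⟨i, hi⟩; exact hrp _ hi) (by rwa [hupd, himg'])
    rw [hupd, ho _ hinj' (by rwa [himg']) (by rwa [himg']), h1] at h2
    exact (neg_injective h2).symm
  -- The sign `ε` is normalized at `k = 3`, where the power of -1 is -1.
  refine ⟨p, -o.sign (p ∘ (3 : Fin 6).succAbove), hp, himg, ?_, ?_⟩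
  · have hnot (k : Fin 6) (hk : p k ∈ ({a, b, c} : Finset V)) : p k ∉ ({d, e, f} : Finset V) :=
      Finset.disjoint_left.1 h.disjoint hk
    have h4 : o.sign (p ∘ (4 : Fin 6).succAbove) = -o.sign (p ∘ (3 : Fin 6).succAbove) := s43
    have h5 : o.sign (p ∘ (5 : Fin 6).succAbove) = -o.sign (p ∘ (4 : Fin 6).succAbove) := s54
    intro k hk
    fin_cases k
    · exact absurd hk (hnot 0 (by simp [hp_def]))
    · exact absurd hk (hnot 1 (by simp [hp_def]))
    · exact absurd hk (hnot 2 (by simp [hp_def]))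
    · simp [pow_succ]
    · exact h4.trans (by simp [pow_succ])
    · exact h5.trans (by rw [h4]; simp [pow_succ])
  · have hnot (k : Fin 6) (hk : p k ∈ ({d, e, f} : Finset V)) : p k ∉ ({a, b, c} : Finset V) :=
      fun hk' => Finset.disjoint_left.1 h.disjoint hk' hk
    have h1 : o'.sign (p ∘ (1 : Fin 6).succAbove) = -o'.sign (p ∘ (0 : Fin 6).succAbove) := s10
    have h2 : o'.sign (p ∘ (2 : Fin 6).succAbove) = -o'.sign (p ∘ (1 : Fin 6).succAbove) := s21
    intro k hk
    rw [← s23, h2, h1]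
    fin_cases k
    · simp
    · exact h1.trans (by simp)
    · exact h2.trans (by rw [h1]; simp)
    · exact absurd hk (hnot 3 (by simp [hp_def]))
    · exact absurd hk (hnot 4 (by simp [hp_def]))
    · exact absurd hk (hnot 5 (by simp [hp_def]))

end AbstractSimplicialComplex

namespace AbstractSimplicialComplex

/-! ### Invariance under the move -/

theorem sign_units_mul (ε : ℤˣ) (x : ℝ) :
    Real.sign (((ε : ℤ) : ℝ) * x / 24) = ((ε : ℤ) : ℝ) * Real.sign x := by
  have h : Real.sign (x / 24) = Real.sign x := by
    rcases lt_trichotomy x 0 with hx | rfl | hx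
    · rw [Real.sign_of_neg hx, Real.sign_of_neg (by linarith)]
    · simp
    · rw [Real.sign_of_pos hx, Real.sign_of_pos (by linarith)]
  rcases Int.units_eq_one_or ε with rfl | rfl
  · simpa using h
  · simpa [neg_div, Real.sign_neg] using h

variable {V : Type*} [Fintype V] {K C : AbstractSimplicialComplex V} {v₀ : V}

open Placement

/-- A vertex set `X` of six points with an affine dependency `w`, whose coefficients are, up to
the common sign `ε`, proportional to the oriented volumes of the old and of the new 4-simplices. -/
structure IsThreeStar.Weights {t u : Finset V} (h : K.IsThreeStar t u) (D : K.Placement v₀)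
    (o : K.SimplexOrientation) (o' : (K.flip t u h).SimplexOrientation) (P : V → E4) (w : V → ℝ)
    (ε : ℤˣ) : Prop where
  isLift : D.IsLift (t ∪ u) P
  sum_eq : ∑ x ∈ t ∪ u, w x = 0
  sum_smul_eq : ∑ x ∈ t ∪ u, w x • P x = 0
  ne_zero : ∀ x ∈ t ∪ u, w x ≠ 0
  det_sq : ∀ v : Fin 5 → V, Function.Injective v → ∀ z ∈ t ∪ u,
    Finset.univ.image v = (t ∪ u).erase z → simplexDet (P ∘ v) ^ 2 = w z ^ 2
  volume_old : ∀ z ∈ u, D.volume o ((t ∪ u).erase z) = ((ε : ℤ) : ℝ) * w z / 24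
  volume_new : ∀ z ∈ t, D.volume o' ((t ∪ u).erase z) = -(((ε : ℤ) : ℝ) * w z / 24)

variable {D : K.Placement v₀}

theorem Placement.IsNondegenerate.simplexDet_ne_zero (hC : D.IsNondegenerate C)
    (hK : K.skeleton.Connected) {X : Finset V} (hX : K.Coherent X) {P : V → E4}
    (hP : D.IsLift X P) {v : Fin 5 → V} (hv : Function.Injective v)
    (hvX : Finset.univ.image v ⊆ X) (hvC : Finset.univ.image v ∈ C.simplices 4) :
    simplexDet (P ∘ v) ≠ 0 := by
  obtain ⟨Q, hQ⟩ := D.exists_isLift hK (X := Finset.univ.image v) (by simp)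
  obtain ⟨φ, hφ0, hφ⟩ := IsLift.exists_motion D hX Finset.Subset.rfl hvX hP hQ
  have h1 := simplexDet_ne_zero_of_simplex (hC _ hvC Q hQ) hv Finset.Subset.rfl
  have h2 : Q ∘ v = φ ∘ (P ∘ v) := funext fun i =>
    hφ _ (hvX (Finset.mem_image_of_mem v (Finset.mem_univ i)))
  rwa [h2, simplexDet_isometry φ hφ0] at h1

/-- The weights are the alternating cofactors of the affine dependency, and their signs match those
of `exists_orientation`. Nondegeneracy of the new complex gives nonzero weights on `t`, that of the
old one on `u`. -/
theorem IsThreeStar.exists_weights {t u : Finset V} (h : K.IsThreeStar t u)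
    (hK : K.IsClosedFourManifold) (hu : u ∉ K.faces) (o : K.SimplexOrientation)
    (o' : (K.flip t u h).SimplexOrientation)
    (ho : ∀ v : Fin 5 → V, Function.Injective v → Finset.univ.image v ∈ K.faces →
      Finset.univ.image v ∈ (K.flip t u h).faces → o'.sign v = o.sign v)
    (hD : D.IsNondegenerate K) (hD' : D.IsNondegenerate (K.flip t u h)) :
    ∃ P w ε, h.Weights D o o' P w ε := by
  obtain ⟨p, ε, hp, himg, hold, hnew⟩ := h.exists_orientation hK hu o o' ho
  obtain ⟨P, hP⟩ := D.exists_isLift hK.connected (X := t ∪ u)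
    (Finset.card_pos.1 (by rw [h.card_union]; norm_num))
  obtain ⟨hc, hcP⟩ := exists_affine_dependency (P ∘ p)
  set c : Fin 6 → ℝ := fun k => (-1) ^ (k : ℕ) * simplexDet ((P ∘ p) ∘ k.succAbove) with hc_def
  let w : V → ℝ := Function.extend p c 0
  have hw (k : Fin 6) : w (p k) = c k := hp.extend_apply c 0 k
  have hmem {z : V} (hz : z ∈ t ∪ u) : ∃ k, p k = z := by
    rw [← himg] at hz
    simpa using hz
  have hinj (k : Fin 6) : Function.Injective (p ∘ k.succAbove) :=
    hp.comp Fin.succAbove_right_injective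
  have himg' (k : Fin 6) : Finset.univ.image (p ∘ k.succAbove) = (t ∪ u).erase (p k) := by
    rw [image_comp_succAbove hp, himg]
  have hsub (k : Fin 6) : Finset.univ.image (p ∘ k.succAbove) ⊆ t ∪ u := by
    rw [himg' k]; exact Finset.erase_subset _ _
  have hmem_new {k : Fin 6} (hk : p k ∈ t) :
      Finset.univ.image (p ∘ k.succAbove) ∈ (K.flip t u h).simplices 4 := by
    rw [himg']; exact h.mem_flip_simplices_four.2 (Or.inr ⟨_, hk, rfl⟩)
  have hmem_old {k : Fin 6} (hk : p k ∈ u) :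
      Finset.univ.image (p ∘ k.succAbove) ∈ K.simplices 4 := by
    rw [himg']; exact h.erase_mem hk
  have hpow (k : Fin 6) : ((-1 : ℝ) ^ (k : ℕ)) * (-1) ^ (k : ℕ) = 1 := by
    rw [← mul_pow]; norm_num
  refine ⟨P, w, ε, hP, ?_, ?_, ?_, ?_, ?_, ?_⟩
  · rw [← himg, Finset.sum_image fun _ _ _ _ hxy => hp hxy]
    simpa only [hw] using hc
  · rw [← himg, Finset.sum_image fun _ _ _ _ hxy => hp hxy]
    simp only [hw]
    exact hcP
  · intro z hz
    obtain ⟨k, rfl⟩ := hmem hz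
    rw [hw]
    refine mul_ne_zero (pow_ne_zero _ (by norm_num)) ?_
    rcases Finset.mem_union.1 hz with hk | hk
    · exact hD'.simplexDet_ne_zero hK.connected h.coherent hP (hinj k) (hsub k) (hmem_new hk)
    · exact hD.simplexDet_ne_zero hK.connected h.coherent hP (hinj k) (hsub k) (hmem_old hk)
  · intro v hv z hz hvz
    obtain ⟨k, rfl⟩ := hmem hz
    obtain ⟨σ, rfl⟩ := exists_perm_of_image_eq hv (hvz.trans (himg' k).symm)
    have h1 : (((Equiv.Perm.sign σ : ℤˣ) : ℤ) : ℝ) * ((Equiv.Perm.sign σ : ℤˣ) : ℤ) = 1 := by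
      rw [← Int.cast_mul, Int.units_coe_mul_self, Int.cast_one]
    have h2 : simplexDet (P ∘ (p ∘ k.succAbove) ∘ σ) = _ :=
      simplexDet_perm (P ∘ p ∘ k.succAbove) σ
    have h3 : c k = (-1) ^ (k : ℕ) * simplexDet (P ∘ p ∘ k.succAbove) := rfl
    rw [hw, h2, h3]
    linear_combination simplexDet (P ∘ p ∘ k.succAbove) ^ 2 * (h1 - hpow k)
  · intro z hz
    obtain ⟨k, rfl⟩ := hmem (Finset.mem_union_right _ hz)
    rw [← himg', volume_eq hK.connected h.coherent hP o (hinj k) (hsub k)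
      (mem_simplices.1 (hmem_old hz)).1, hold k hz, hw]
    push_cast
    simp only [hc_def, Function.comp_assoc]
    ring
  · intro z hz
    obtain ⟨k, rfl⟩ := hmem (Finset.mem_union_left _ hz)
    rw [← himg', volume_eq hK.connected h.coherent hP o' (hinj k) (hsub k)
      (mem_simplices.1 (hmem_new hz)).1, hnew k hz, hw]
    push_cast
    simp only [hc_def, Function.comp_assoc]
    ring

theorem IsThreeStar.volume_common {t u : Finset V} (h : K.IsThreeStar t u)
    (hK : K.IsClosedFourManifold) (o : K.SimplexOrientation)
    (o' : (K.flip t u h).SimplexOrientation)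
    (ho : ∀ v : Fin 5 → V, Function.Injective v → Finset.univ.image v ∈ K.faces →
      Finset.univ.image v ∈ (K.flip t u h).faces → o'.sign v = o.sign v)
    {s : Finset V} (hs : s ∈ (K.simplices 4).filter fun s => ¬ t ⊆ s) :
    D.volume o' s = D.volume o s := by
  obtain ⟨hs4, hts⟩ := Finset.mem_filter.1 hs
  obtain ⟨hsK, hcard⟩ := mem_simplices.1 hs4
  have hs' : s ∈ (K.flip t u h).faces := Or.inl ⟨hsK, hts⟩
  obtain ⟨v, hv, rfl⟩ : ∃ v : Fin 5 → V, Function.Injective v ∧ Finset.univ.image v = s := by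
    let e := (Fintype.equivFinOfCardEq (α := s) (n := 5) (by simpa using hcard)).symm
    refine ⟨fun i => e i, fun i j hij => e.injective (Subtype.ext hij), ?_⟩
    ext x
    simp only [Finset.mem_image, Finset.mem_univ, true_and]
    exact ⟨fun ⟨i, hi⟩ => hi ▸ (e i).2, fun hx => ⟨e.symm ⟨x, hx⟩, by simp⟩⟩
  obtain ⟨P, hP⟩ := D.exists_isLift hK.connected (X := Finset.univ.image v) (by simp)
  have hX := coherent_of_mem_faces hsK
  rw [volume_eq hK.connected hX hP o hv Finset.Subset.rfl hsK,
    volume_eq hK.connected hX hP o' hv Finset.Subset.rfl hs', ho v hv hsK hs']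

/-! ### Sums and products over 4-simplices, split at the star. -/

theorem IsThreeStar.sum_old {M : Type*} [AddCommMonoid M] {t u : Finset V}
    (h : K.IsThreeStar t u) (g : Finset V → M) : ∑ s ∈ K.simplices 4, g s =
      (∑ s ∈ (K.simplices 4).filter (fun s => ¬ t ⊆ s), g s) +
        ∑ z ∈ u, g ((t ∪ u).erase z) := by
  conv_lhs => rw [h.simplices_four_eq]
  rw [Finset.sum_union h.disjoint_old, Finset.sum_image]
  exact fun x hx y hy => (Finset.erase_inj _ (Finset.mem_union_right _ hx)).1

theorem IsThreeStar.sum_new {M : Type*} [AddCommMonoid M] {t u : Finset V}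
    (h : K.IsThreeStar t u) (hu : u ∉ K.faces) (g : Finset V → M) :
    ∑ s ∈ (K.flip t u h).simplices 4, g s =
      (∑ s ∈ (K.simplices 4).filter (fun s => ¬ t ⊆ s), g s) +
        ∑ z ∈ t, g ((t ∪ u).erase z) := by
  conv_lhs => rw [h.flip_simplices_four_eq]
  rw [Finset.sum_union (h.disjoint_new hu), Finset.sum_image]
  exact fun x hx y hy => (Finset.erase_inj _ (Finset.mem_union_left _ hx)).1

theorem IsThreeStar.prod_old {M : Type*} [CommMonoid M] {t u : Finset V}
    (h : K.IsThreeStar t u) (g : Finset V → M) : ∏ s ∈ K.simplices 4, g s =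
      (∏ s ∈ (K.simplices 4).filter (fun s => ¬ t ⊆ s), g s) *
        ∏ z ∈ u, g ((t ∪ u).erase z) := by
  conv_lhs => rw [h.simplices_four_eq]
  rw [Finset.prod_union h.disjoint_old, Finset.prod_image]
  exact fun x hx y hy => (Finset.erase_inj _ (Finset.mem_union_right _ hx)).1

theorem IsThreeStar.prod_new {M : Type*} [CommMonoid M] {t u : Finset V}
    (h : K.IsThreeStar t u) (hu : u ∉ K.faces) (g : Finset V → M) :
    ∏ s ∈ (K.flip t u h).simplices 4, g s =
      (∏ s ∈ (K.simplices 4).filter (fun s => ¬ t ⊆ s), g s) *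
        ∏ z ∈ t, g ((t ∪ u).erase z) := by
  conv_lhs => rw [h.flip_simplices_four_eq]
  rw [Finset.prod_union (h.disjoint_new hu), Finset.prod_image]
  exact fun x hx y hy => (Finset.erase_inj _ (Finset.mem_union_left _ hx)).1

/-- The common 4-simplices cancel. The minus in the new volumes gives removed and added 4-simplices
the same sign in the difference, which becomes a sum over the whole boundary of the 5-simplex. -/
theorem IsThreeStar.deficit_flip {t u : Finset V} (h : K.IsThreeStar t u)
    (hK : K.IsClosedFourManifold) (hu : u ∉ K.faces) {o : K.SimplexOrientation}
    {o' : (K.flip t u h).SimplexOrientation}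
    (ho : ∀ v : Fin 5 → V, Function.Injective v → Finset.univ.image v ∈ K.faces →
      Finset.univ.image v ∈ (K.flip t u h).faces → o'.sign v = o.sign v)
    {P : V → E4} {w : V → ℝ} {ε : ℤˣ} (hw : h.Weights D o o' P w ε) (r : Finset V)
    (L : Finset V → ℝ) :
    D.deficit o' r L = D.deficit o r L + ((ε : ℤ) : ℝ) *
      ∑ z ∈ (t ∪ u).filter (fun z => r ⊆ (t ∪ u).erase z),
        Real.sign (w z) * dihedralAngle L r ((t ∪ u).erase z) := by
  have hcommon : ∑ s ∈ (K.simplices 4).filter (fun s => ¬ t ⊆ s),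
      (if r ⊆ s then Real.sign (D.volume o' s) * dihedralAngle L r s else 0) =
      ∑ s ∈ (K.simplices 4).filter (fun s => ¬ t ⊆ s),
      (if r ⊆ s then Real.sign (D.volume o s) * dihedralAngle L r s else 0) :=
    Finset.sum_congr rfl fun s hs => by rw [h.volume_common hK o o' ho hs]
  rw [deficit, deficit, Finset.sum_filter, Finset.sum_filter, Finset.sum_filter, h.sum_new hu,
    h.sum_old, hcommon, Finset.sum_union h.disjoint, mul_add, Finset.mul_sum, Finset.mul_sum]
  have hnew : ∑ z ∈ t, (if r ⊆ (t ∪ u).erase z then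
      Real.sign (D.volume o' ((t ∪ u).erase z)) * dihedralAngle L r ((t ∪ u).erase z) else 0) =
      -∑ z ∈ t, ((ε : ℤ) : ℝ) * (if r ⊆ (t ∪ u).erase z then
        Real.sign (w z) * dihedralAngle L r ((t ∪ u).erase z) else 0) := by
    rw [← Finset.sum_neg_distrib]
    refine Finset.sum_congr rfl fun z hz => ?_
    rw [hw.volume_new z hz, Real.sign_neg, sign_units_mul]
    split_ifs <;> ring
  have hold : ∑ z ∈ u, (if r ⊆ (t ∪ u).erase z then
      Real.sign (D.volume o ((t ∪ u).erase z)) * dihedralAngle L r ((t ∪ u).erase z) else 0) =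
      ∑ z ∈ u, ((ε : ℤ) : ℝ) * (if r ⊆ (t ∪ u).erase z then
        Real.sign (w z) * dihedralAngle L r ((t ∪ u).erase z) else 0) := by
    refine Finset.sum_congr rfl fun z hz => ?_
    rw [hw.volume_old z hz, sign_units_mul]
    split_ifs <;> ring
  rw [hnew, hold]
  ring

theorem Placement.differentiableAt_deficit_update {o : C.SimplexOrientation} {t e : Finset V}
    (h : DifferentiableAt ℝ (D.deficit o t) D.sqLength) :
    DifferentiableAt ℝ (fun l => D.deficit o t (Function.update D.sqLength e l))
      (D.sqLength e) := by
  have h' : DifferentiableAt ℝ (D.deficit o t)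
      (Function.update D.sqLength e (D.sqLength e)) := by rwa [Function.update_eq_self]
  exact h'.comp (D.sqLength e) (hasDerivAt_update D.sqLength e (D.sqLength e)).differentiableAt

/-- The factor that depends on the row in the change of the matrix of derivatives of the deficit
angles. -/
def rowFactor (D : K.Placement v₀) (X : Finset V) (w : V → ℝ) (r : Finset V) : ℝ :=
  if r ⊆ X then D.area r / (2 * ∏ z ∈ X \ r, w z) else 0

/-- The factor that depends on the column in the change of the matrix of derivatives of the deficit
angles. -/
def columnFactor (X : Finset V) (w : V → ℝ) (e : Finset V) : ℝ :=
  ∑ x ∈ X, ∑ y ∈ X, w x * w y * sqDist (Pi.single e 1) x y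

/-- The difference of deficit angles has a derivative that factors into a row part and a column
part, so the change has rank one. A face not inside the star sees none of the exchanged 4-simplices.
-/
theorem IsThreeStar.deficitDeriv_flip {t u : Finset V} (h : K.IsThreeStar t u)
    (hK : K.IsClosedFourManifold) (hu : u ∉ K.faces) {o : K.SimplexOrientation}
    {o' : (K.flip t u h).SimplexOrientation}
    (ho : ∀ v : Fin 5 → V, Function.Injective v → Finset.univ.image v ∈ K.faces →
      Finset.univ.image v ∈ (K.flip t u h).faces → o'.sign v = o.sign v)
    (hD : D.IsNondegenerate K) {P : V → E4} {w : V → ℝ} {ε : ℤˣ}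
    (hw : h.Weights D o o' P w ε) {r : Finset V} (hr : r.card = 3) (e : Finset V) :
    D.deficitDeriv o' r e = D.deficitDeriv o r e +
      ((ε : ℤ) : ℝ) * rowFactor D (t ∪ u) w r * columnFactor (t ∪ u) w e := by
  have hdiff := differentiableAt_deficit_update (e := e) (hD.differentiableAt_deficit hK.connected
    (fun _ => coherent_of_mem_simplices) o hr)
  have hder : HasDerivAt (fun l => ∑ z ∈ (t ∪ u).filter (fun z => r ⊆ (t ∪ u).erase z),
      Real.sign (w z) * dihedralAngle (Function.update D.sqLength e l) r ((t ∪ u).erase z))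
      (rowFactor D (t ∪ u) w r * columnFactor (t ∪ u) w e) (D.sqLength e) := by
    by_cases hrX : r ⊆ t ∪ u
    · have hfilter : (t ∪ u).filter (fun z => r ⊆ (t ∪ u).erase z) = (t ∪ u) \ r := by
        ext z
        rw [Finset.mem_filter, Finset.mem_sdiff]
        refine and_congr_right fun _ => ⟨fun hz hzr => Finset.notMem_erase z _ (hz hzr),
          fun hz x hx => Finset.mem_erase.2 ⟨fun hxz => hz (hxz ▸ hx), hrX hx⟩⟩
      rw [hfilter]
      refine (hasDerivAt_signed_dihedralAngle_sum hK.connected h.coherent h.card_union hw.isLift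
        hw.sum_eq hw.sum_smul_eq hw.ne_zero hw.det_sq hr hrX e).congr_deriv ?_
      rw [rowFactor, if_pos hrX, columnFactor]
      ring
    · have hfilter : (t ∪ u).filter (fun z => r ⊆ (t ∪ u).erase z) = ∅ :=
        Finset.filter_eq_empty_iff.2 fun z _ hz => hrX (hz.trans (Finset.erase_subset _ _))
      rw [hfilter, rowFactor, if_neg hrX, zero_mul]
      simpa using hasDerivAt_const (D.sqLength e) (0 : ℝ)
  have hfun : (fun l => D.deficit o' r (Function.update D.sqLength e l)) = fun l =>
      D.deficit o r (Function.update D.sqLength e l) + ((ε : ℤ) : ℝ) *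
      ∑ z ∈ (t ∪ u).filter (fun z => r ⊆ (t ∪ u).erase z), Real.sign (w z) *
        dihedralAngle (Function.update D.sqLength e l) r ((t ∪ u).erase z) :=
    funext fun l => h.deficit_flip hK hu ho hw r _
  rw [deficitDeriv, hfun, mul_assoc]
  exact (hdiff.hasDerivAt.add (hder.const_mul ((ε : ℤ) : ℝ))).deriv

theorem Placement.deficitDeriv_eq_zero {o : C.SimplexOrientation} {r : Finset V}
    (hr : ∀ s ∈ C.simplices 4, ¬ r ⊆ s) (e : Finset V) : D.deficitDeriv o r e = 0 := by
  have h : (C.simplices 4).filter (fun s => r ⊆ s) = ∅ := Finset.filter_eq_empty_iff.2 hr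
  simp [deficitDeriv, deficit, h]

theorem IsThreeStar.Weights.area_ne_zero {t u : Finset V} {h : K.IsThreeStar t u}
    {o : K.SimplexOrientation} {o' : (K.flip t u h).SimplexOrientation} {P : V → E4} {w : V → ℝ}
    {ε : ℤˣ} (hw : h.Weights D o o' P w ε) (hK : K.skeleton.Connected) : D.area u ≠ 0 := by
  obtain ⟨y, hy⟩ := Finset.card_pos.1 (by rw [h.card_left]; norm_num : 0 < t.card)
  have hyX : y ∈ t ∪ u := Finset.mem_union_left _ hy
  obtain ⟨a, b, c, d, e, hinj, hu, hs⟩ := exists_enumeration_five (t := u) (s := (t ∪ u).erase y)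
    h.card_right (fun x hx => Finset.mem_erase.2
      ⟨fun hxy => Finset.disjoint_left.1 h.disjoint hy (hxy ▸ hx), Finset.mem_union_right _ hx⟩)
    (by rw [Finset.card_erase_of_mem hyX, h.card_union])
  have hdet := hw.det_sq _ hinj y hyX (by rw [image_five, hs])
  have hdet0 : simplexDet (P ∘ ![a, b, c, d, e]) ≠ 0 := fun h0 => by
    rw [h0] at hdet
    exact hw.ne_zero y hyX ((pow_eq_zero_iff two_ne_zero).1 (hdet.symm.trans
      (zero_pow two_ne_zero)))
  have hsub : ({a, b, c, d, e} : Finset V) ⊆ t ∪ u := hs ▸ Finset.erase_subset _ _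
  have hreal := (realizes_sqLength hK h.coherent hw.isLift).mono hsub
  obtain ⟨hb, hc, -⟩ := schur_simplexDet P hdet0
  beta_reduce at hb
  rw [hreal.inner_eq (by simp) (by simp) (by simp)] at hb
  rw [hreal.schur_eq (by simp) (by simp) (by simp) (by simp)] at hc
  have hne (i j : Fin 5) (hij : i ≠ j) : ![a, b, c, d, e] i ≠ ![a, b, c, d, e] j := hinj.ne hij
  rw [hu, area_eq (a := a) (b := b) (c := c) hK h.coherent (hsub (by simp)) (hsub (by simp))
    (hsub (by simp)) (hne 0 1 (by decide)) (hne 0 2 (by decide)) (hne 1 2 (by decide)) hb.ne']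
  exact (div_pos (Real.sqrt_pos.2 (mul_pos hb hc)) two_pos).ne'

theorem det_of_rows_eq {m : ℕ} {A B : Matrix (Fin m) (Fin m) ℝ} {i₀ : Fin m} {k : Fin m → ℝ}
    {β : ℝ} (h₀ : ∀ j, B i₀ j = β * A i₀ j) (h : ∀ i ≠ i₀, ∀ j, B i j = A i j + k i * A i₀ j) :
    B.det = β * A.det := by
  have h1 : (B.updateRow i₀ (A i₀)).det = A.det := by
    refine Matrix.det_eq_of_forall_row_eq_smul_add_const (fun i => if i = i₀ then 0 else k i) i₀
      (if_pos rfl) fun i j => ?_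
    by_cases hi : i = i₀
    · simp [hi]
    · simp [hi, h i hi j]
  have h2 : B = B.updateRow i₀ (β • A i₀) := by
    ext i j
    by_cases hi : i = i₀
    · subst hi; simp [h₀]
    · simp [hi]
  rw [h2, Matrix.det_updateRow_smul, h1]

theorem IsThreeStar.invariantExpr_flip {t u : Finset V} (h : K.IsThreeStar t u)
    (hK : K.IsClosedFourManifold) (hu : u ∉ K.faces) {o : K.SimplexOrientation}
    {o' : (K.flip t u h).SimplexOrientation}
    (ho : ∀ v : Fin 5 → V, Function.Injective v → Finset.univ.image v ∈ K.faces →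
      Finset.univ.image v ∈ (K.flip t u h).faces → o'.sign v = o.sign v)
    (hD : D.IsNondegenerate K) (hD' : D.IsNondegenerate (K.flip t u h)) (ht : t ∈ K.simplices 2)
    {m : ℕ} {r c : Fin m → Finset V} (hr : ∀ i, r i ∈ K.simplices 2) {i₀ : Fin m} (hi₀ : r i₀ = t)
    (hdet : (D.deficitMatrix o r c).det ≠ 0) :
    D.invariantExpr o' (Function.update r i₀ u) c = D.invariantExpr o r c := by
  obtain ⟨P, w, ε, hw⟩ := h.exists_weights hK hu o o' ho hD hD'
  set X := t ∪ u with hX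
  have hrow {s : Finset V} (hs : s.card = 3) (e : Finset V) :=
    h.deficitDeriv_flip hK hu ho hD hw hs e
  have hrow_t (e : Finset V) : D.deficitDeriv o t e =
      -(((ε : ℤ) : ℝ) * rowFactor D X w t * columnFactor X w e) := by
    have h0 : D.deficitDeriv o' t e = 0 := deficitDeriv_eq_zero (fun s hs hts => by
      rcases h.mem_flip_simplices_four.1 hs with ⟨-, hs⟩ | ⟨y, hy, rfl⟩
      · exact hs hts
      · exact Finset.notMem_erase y _ (hts hy)) e
    linarith [hrow h.card_left e]
  have hrow_u (e : Finset V) : D.deficitDeriv o' u e =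
      ((ε : ℤ) : ℝ) * rowFactor D X w u * columnFactor X w e := by
    have h0 : D.deficitDeriv o u e = 0 := deficitDeriv_eq_zero (fun s hs hus =>
      hu (face_subset (mem_simplices.1 hs).1 hus
        (Finset.card_pos.1 (by rw [h.card_right]; norm_num)))) e
    linarith [hrow h.card_right e]
  -- Otherwise the old row of `t` would vanish, against the nonzero determinant. This permits
  -- division by the factor below.
  have hCt : rowFactor D X w t ≠ 0 := fun h0 => hdet (Matrix.det_eq_zero_of_row_eq_zero i₀
    fun j => by
      show D.deficitDeriv o (r i₀) (c j) = 0
      rw [hi₀, hrow_t, h0]; ring)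
  have hdet' : (D.deficitMatrix o' (Function.update r i₀ u) c).det =
      -(rowFactor D X w u / rowFactor D X w t) * (D.deficitMatrix o r c).det := by
    refine det_of_rows_eq (i₀ := i₀) (k := fun i => -(rowFactor D X w (r i) / rowFactor D X w t))
      (fun j => ?_) fun i hi j => ?_
    · show D.deficitDeriv o' (Function.update r i₀ u i₀) (c j) =
        _ * D.deficitDeriv o (r i₀) (c j)
      rw [Function.update_self, hi₀, hrow_t, hrow_u]
      field_simp
    · show D.deficitDeriv o' (Function.update r i₀ u i) (c j) = D.deficitDeriv o (r i) (c j) +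
        _ * D.deficitDeriv o (r i₀) (c j)
      rw [Function.update_of_ne hi, hi₀, hrow_t, hrow (mem_simplices.1 (hr i)).2]
      field_simp
      ring
  have hsdt : X \ t = u := Finset.union_sdiff_cancel_left h.disjoint
  have hsdu : X \ u = t := Finset.union_sdiff_cancel_right h.disjoint
  have hFt : rowFactor D X w t = D.area t / (2 * ∏ z ∈ u, w z) := by
    rw [rowFactor, if_pos Finset.subset_union_left, hsdt]
  have hFu : rowFactor D X w u = D.area u / (2 * ∏ z ∈ t, w z) := by
    rw [rowFactor, if_pos Finset.subset_union_right, hsdu]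
  rw [hFt] at hCt
  rw [hFt, hFu] at hdet'
  have hprod {s : Finset V} (hs : s ⊆ X) : ∏ z ∈ s, w z ≠ 0 :=
    Finset.prod_ne_zero_iff.2 fun z hz => hw.ne_zero z (hs hz)
  have ht0 := hprod (Finset.subset_union_left : t ⊆ X)
  have hu0 := hprod (Finset.subset_union_right : u ⊆ X)
  have hAu := hw.area_ne_zero hK.connected
  have hAt : D.area t ≠ 0 := fun h0 => hCt (by rw [h0, zero_div])
  have huK : u ∉ (K.simplices 2).erase t := fun hmem =>
    hu (mem_simplices.1 (Finset.mem_of_mem_erase hmem)).1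
  -- Three volumes are exchanged for three, so the constant is common to both products; the minus of
  -- the new one cancels that of `hdet'`.
  have hVu : ∏ z ∈ u, D.volume o (X.erase z) = ((ε : ℤ) : ℝ) ^ 3 / 24 ^ 3 * ∏ z ∈ u, w z := by
    rw [Finset.prod_congr rfl hw.volume_old]
    simp only [mul_div_right_comm]
    rw [Finset.prod_mul_distrib, Finset.prod_const, h.card_right, div_pow]
  have hVt : ∏ z ∈ t, D.volume o' (X.erase z) =
      -(((ε : ℤ) : ℝ) ^ 3 / 24 ^ 3) * ∏ z ∈ t, w z := by
    rw [Finset.prod_congr rfl hw.volume_new]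
    simp only [mul_div_right_comm, ← neg_mul]
    rw [Finset.prod_mul_distrib, Finset.prod_const, h.card_left]
    ring
  rw [invariantExpr, invariantExpr, hdet', h.flip_simplices_two, Finset.prod_insert huK,
    ← Finset.mul_prod_erase _ _ ht, h.prod_new hu, h.prod_old, hVu, hVt,
    Finset.prod_congr rfl fun s hs => h.volume_common hK o o' ho hs]
  field_simp

end AbstractSimplicialComplex

end

theorem theorem3 {V : Type*} [Fintype V] (K : AbstractSimplicialComplex V)
    (hK : K.IsClosedFourManifold) (o : K.SimplexOrientation) (v₀ : V) (D : K.Placement v₀)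
    (hD : D.IsNondegenerate K) {m : ℕ} (r c : Fin m → Finset V)
    (hB : D.IsLargestNonsingular o r c) (i₀ : Fin m)
    (h3 : ((K.simplices 4).filter fun s => r i₀ ⊆ s).card = 3) :
    (∀ t ∈ K.simplices 2, DifferentiableAt ℝ (D.deficit o t) D.sqLength) ∧
    ∃ (u : Finset V) (hu : K.IsThreeStar (r i₀) u), u ∉ K.faces →
      ∀ o' : (K.flip (r i₀) u hu).SimplexOrientation,
        (∀ v : Fin 5 → V, Function.Injective v → Finset.univ.image v ∈ K.faces →
          Finset.univ.image v ∈ (K.flip (r i₀) u hu).faces → o'.sign v = o.sign v) →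
        D.IsNondegenerate (K.flip (r i₀) u hu) →
        (∀ t ∈ (K.flip (r i₀) u hu).simplices 2,
          DifferentiableAt ℝ (D.deficit o' t) D.sqLength) ∧
        D.invariantExpr o' (Function.update r i₀ u) c = D.invariantExpr o r c := by
  refine ⟨fun t ht => hD.differentiableAt_deficit hK.connected
    (fun _ => AbstractSimplicialComplex.coherent_of_mem_simplices) o
    (AbstractSimplicialComplex.mem_simplices.1 ht).2, ?_⟩
  obtain ⟨u, h⟩ := hK.exists_isThreeStar (hB.1 i₀) h3
  exact ⟨u, h, fun hu o' ho hD' => ⟨fun t ht => hD'.differentiableAt_deficit hK.connected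
    h.coherent_flip o' (AbstractSimplicialComplex.mem_simplices.1 ht).2,
    h.invariantExpr_flip hK hu ho hD hD' (hB.1 i₀) hB.1 rfl hB.2.2.1⟩⟩
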